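/- Let $M$ be a complete smooth Riemannian manifold with Levi-Civita connection $\nabla^0$ and $\dim M = n+1 > 3$. Let $\mathcal V$ be a smooth unit vector field on $M$ that is anti-torqued, i.e. there is a smooth nowhere vanishing function $f$ on $M$ with $$\nabla^0_X\mathcal V = fX - f\langle X,\mathcal V\rangle \mathcal V \quad\text{for all } X\in\mathfrak X(M).$$ Let $\phi: N\to M$ be a smooth isometric immersion of an $n$-dimensional Riemannian manifold with a smooth unit normal vector field $U$ along $\phi$, and suppose that $N$ is a constant angle hypersurface with axis $\mathcal V$: for some constant $\theta\in[0,\pi]$ one has $\langle U,\mathcal V\rangle=\cos\theta$ on $N$, and the tangential component $\mathcal V^\top$ of $\mathcal V$ vanishes nowhere on $N$. Put $T=\mathcal V^\top/|\mathcal V^\top|$. Then one of the following holds. 1. $\cos\theta = 0$ and $N$ is a ruled hypersurface of $M$, i.e. $N$ carries a smooth foliation by curves which $\phi$ maps to geodesics of $M$. 2. $\cos\theta\neq 0$ and, for the smooth unit vector field $T$, there is the orthogonal decomposition $TN=\operatorname{span}\{T\}\oplus\mathcal D$ with $\mathcal D=\operatorname{span}\{T\}^\perp$, where the integral curves of $T$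 are geodesics of $N$ and the distribution $\mathcal D$ is integrable (through every point of $N$ passes an integral manifold of $\mathcal D$). -/

import Mathlib

open Set Bundle Manifold
open scoped ContDiff Topology InnerProductSpace

noncomputable section

namespace ConstantAngle

/-! ## The Levi-Civita connection and geodesics

Manifolds are modelled on a finite-dimensional real vector space `E` (hence have no boundary).  The
tangent space at `x` is identified with `E` through the preferred chart at `x`, so that a vector
`u : TangentSpace 𝓘(ℝ, E) x` is at the same time the vector of its components in that chart. -/

/-- Christoffel symbols of the first kind of a metric `g` on (an open subset of) a vector space,
where `g y v w` is the inner product of `v` and `w` at the point `y`: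
`Γ(u, v; w) = (∂ᵤ g(v, w) + ∂ᵥ g(u, w) - ∂_w g(u, v)) / 2` at the point `y`. -/
def christoffelFirst {E : Type*} [NormedAddCommGroup E] [NormedSpace ℝ E]
    (g : E → E → E → ℝ) (y u v w : E) : ℝ :=
  (fderiv ℝ (fun z ↦ g z v w) y u + fderiv ℝ (fun z ↦ g z u w) y v -
    fderiv ℝ (fun z ↦ g z u v) y w) / 2

section Connection

variable {E : Type*} [NormedAddCommGroup E] [NormedSpace ℝ E]
  {M : Type*} [TopologicalSpace M] [ChartedSpace E M] [IsManifold 𝓘(ℝ, E) ∞ M]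

/-- The components of the vector field `Y` in the preferred chart at `x`, as a function of the
coordinates. -/
def chartField (Y : Π x : M, TangentSpace 𝓘(ℝ, E) x) (x : M) (y : E) : E :=
  let q : M := (extChartAt 𝓘(ℝ, E) x).symm y
  (trivializationAt E (TangentSpace 𝓘(ℝ, E) : M → Type _) x).continuousLinearMapAt ℝ q (Y q)

instance [FiniteDimensional ℝ E] (x : M) : FiniteDimensional ℝ (TangentSpace 𝓘(ℝ, E) x) :=
  inferInstanceAs (FiniteDimensional ℝ E)

variable [RiemannianBundle (fun x : M ↦ TangentSpace 𝓘(ℝ, E) x)]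

/-- The components of the Riemannian metric in the preferred chart at `x`, as a function of the
coordinates. -/
def chartMetric (x : M) (y v w : E) : ℝ :=
  let q : M := (extChartAt 𝓘(ℝ, E) x).symm y
  let e : E →L[ℝ] TangentSpace 𝓘(ℝ, E) q :=
    (trivializationAt E (TangentSpace 𝓘(ℝ, E) : M → Type _) x).symmL ℝ q
  ⟪e v, e w⟫_ℝ

variable [FiniteDimensional ℝ E]

/-- Christoffel symbols (of the second kind) at `x` in the preferred chart at `x`: the vector
`Γ(u, v)` with `⟪Γ(u, v), w⟫ = Γ(u, v; w)` for all `w`. -/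
def christoffel (x : M) (u v : TangentSpace 𝓘(ℝ, E) x) : TangentSpace 𝓘(ℝ, E) x :=
  let b := stdOrthonormalBasis ℝ (TangentSpace 𝓘(ℝ, E) x)
  ∑ i, christoffelFirst (chartMetric x) (extChartAt 𝓘(ℝ, E) x x) u v (b i) • b i

/-- The Levi-Civita covariant derivative `∇ᵤ Y` at the point `x`, in coordinates:
`uⁱ ∂ᵢ Yᵏ + Γᵏᵢⱼ uⁱ Yʲ`. -/
def leviCivita (Y : Π x : M, TangentSpace 𝓘(ℝ, E) x) (x : M) (u : TangentSpace 𝓘(ℝ, E) x) :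
    TangentSpace 𝓘(ℝ, E) x :=
  let dY : TangentSpace 𝓘(ℝ, E) x := fderiv ℝ (chartField Y x) (extChartAt 𝓘(ℝ, E) x x) u
  dY + christoffel x u (Y x)

/-- The covariant acceleration `∇_{γ'} γ'` of a curve at time `t`, in coordinates:
`(γᵏ)'' + Γᵏᵢⱼ (γⁱ)' (γʲ)'`. -/
def covariantAcceleration (γ : ℝ → M) (t : ℝ) : TangentSpace 𝓘(ℝ, E) (γ t) :=
  let c : ℝ → E := fun s ↦ extChartAt 𝓘(ℝ, E) (γ t) (γ s)
  let c' : TangentSpace 𝓘(ℝ, E) (γ t) := deriv c t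
  let c'' : TangentSpace 𝓘(ℝ, E) (γ t) := deriv (deriv c) t
  c'' + christoffel (γ t) c' c'

/-- `γ` is a (smooth, affinely parametrized) geodesic on the open set `s` of times. -/
def IsGeodesicOn (γ : ℝ → M) (s : Set ℝ) : Prop :=
  ContMDiffOn 𝓘(ℝ, ℝ) 𝓘(ℝ, E) ∞ γ s ∧
    ∀ t ∈ s, covariantAcceleration (E := E) γ t = 0

/-! ## Torse-forming and anti-torqued vector fields -/

/-- `V` is a torse-forming vector field with conformal scalar `f` and generating form `η`:
`∇ᵤ V = f u + η(u) V`. -/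
def IsTorseForming (V : Π x : M, TangentSpace 𝓘(ℝ, E) x) (f : M → ℝ)
    (η : Π x : M, TangentSpace 𝓘(ℝ, E) x →L[ℝ] ℝ) : Prop :=
  ∀ (x : M) (u : TangentSpace 𝓘(ℝ, E) x), leviCivita V x u = f x • u + η x u • V x

/-- `V` is a smooth anti-torqued vector field: torse-forming with a smooth nowhere vanishing
conformal scalar `f` and generating form `-f ν`, where `ν` is the 1-form dual to `V`. -/
def IsAntiTorqued (V : Π x : M, TangentSpace 𝓘(ℝ, E) x) : Prop :=
  ContMDiff 𝓘(ℝ, E) 𝓘(ℝ, E).tangent ∞ (fun x ↦ (⟨x, V x⟩ : TangentBundle 𝓘(ℝ, E) M)) ∧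
    ∃ f : M → ℝ, ContMDiff 𝓘(ℝ, E) 𝓘(ℝ, ℝ) ∞ f ∧ (∀ x, f x ≠ 0) ∧
      IsTorseForming V f (fun x ↦ -f x • innerSL ℝ (V x))

end Connection

/-! ## Distributions -/

section Distribution

variable {F : Type*} [NormedAddCommGroup F] [NormedSpace ℝ F]
  {N : Type*} [TopologicalSpace N] [ChartedSpace F N]

/-- A distribution `D` on `N` is integrable if through every point `p` passes an integral manifold,
that is, an injectively immersed manifold whose tangent spaces are the spaces of `D`; it is given
by a parametrization `ι` with open domain `W` in some `ℝᵏ`. -/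
def IsIntegrable (D : Π x : N, Submodule ℝ (TangentSpace 𝓘(ℝ, F) x)) : Prop :=
  ∀ p : N, ∃ (k : ℕ) (W : Set (EuclideanSpace ℝ (Fin k))) (ι : EuclideanSpace ℝ (Fin k) → N),
    IsOpen W ∧ p ∈ ι '' W ∧ InjOn ι W ∧ ContMDiffOn (𝓡 k) 𝓘(ℝ, F) ∞ ι W ∧
      ∀ y ∈ W, Function.Injective (mfderiv (𝓡 k) 𝓘(ℝ, F) ι y) ∧
        (mfderiv (𝓡 k) 𝓘(ℝ, F) ι y).range = D (ι y)

/-- `T` spans a smooth line field in `TN`, there is the orthogonal decomposition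
`TN = span {T} ⊕ D` with `D = span {T}^⊥`, the integral curves of `T` are geodesics of `N`, and `D`
is integrable. -/
def HasGeodesicSplitting [FiniteDimensional ℝ F] [IsManifold 𝓘(ℝ, F) ∞ N]
    [RiemannianBundle (fun x : N ↦ TangentSpace 𝓘(ℝ, F) x)]
    (T : Π x : N, TangentSpace 𝓘(ℝ, F) x) : Prop :=
  ContMDiff 𝓘(ℝ, F) 𝓘(ℝ, F).tangent ∞ (fun x ↦ (⟨x, T x⟩ : TangentBundle 𝓘(ℝ, F) N)) ∧
    (∀ x, T x ≠ 0) ∧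
    ∃ D : Π x : N, Submodule ℝ (TangentSpace 𝓘(ℝ, F) x),
      (∀ x, D x = (Submodule.span ℝ {T x})ᗮ) ∧
      (∀ x, IsCompl (Submodule.span ℝ {T x}) (D x)) ∧
      (∀ (γ : ℝ → N) (s : Set ℝ), IsOpen s → IsMIntegralCurveOn γ T s →
        IsGeodesicOn (E := F) γ s) ∧
      IsIntegrable D

end Distribution

/-! ## Hypersurfaces -/

section Hypersurface

variable {E : Type*} [NormedAddCommGroup E] [NormedSpace ℝ E] [FiniteDimensional ℝ E]
  {M : Type*} [TopologicalSpace M] [ChartedSpace E M] [IsManifold 𝓘(ℝ, E) ∞ M]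
  [RiemannianBundle (fun x : M ↦ TangentSpace 𝓘(ℝ, E) x)]
  {F : Type*} [NormedAddCommGroup F] [NormedSpace ℝ F] [FiniteDimensional ℝ F]
  {N : Type*} [TopologicalSpace N] [ChartedSpace F N] [IsManifold 𝓘(ℝ, F) ∞ N]
  [RiemannianBundle (fun x : N ↦ TangentSpace 𝓘(ℝ, F) x)]

/-- `φ` is a smooth isometric immersion (its differentials preserve inner products, so they are
injective). -/
def IsIsometricImmersion (φ : N → M) : Prop :=
  ContMDiff 𝓘(ℝ, F) 𝓘(ℝ, E) ∞ φ ∧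
    ∀ (x : N) (u v : TangentSpace 𝓘(ℝ, F) x),
      ⟪mfderiv 𝓘(ℝ, F) 𝓘(ℝ, E) φ x u, mfderiv 𝓘(ℝ, F) 𝓘(ℝ, E) φ x v⟫_ℝ = ⟪u, v⟫_ℝ

/-- `U` is a smooth unit normal vector field along `φ`. -/
def IsUnitNormal (φ : N → M) (U : Π x : N, TangentSpace 𝓘(ℝ, E) (φ x)) : Prop :=
  ContMDiff 𝓘(ℝ, F) 𝓘(ℝ, E).tangent ∞ (fun x ↦ (⟨φ x, U x⟩ : TangentBundle 𝓘(ℝ, E) M)) ∧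
    (∀ x, ‖U x‖ = 1) ∧
    ∀ (x : N) (w : TangentSpace 𝓘(ℝ, F) x), ⟪U x, mfderiv 𝓘(ℝ, F) 𝓘(ℝ, E) φ x w⟫_ℝ = 0

/-- The tangential component `V^⊤` of `V` along `φ`: the tangent vector of `N` at `x` with
`⟪V^⊤, w⟫ = ⟪V, dφ w⟫` for all `w`.  For an isometric immersion this is the vector whose image under
`dφ` is the orthogonal projection of `V` to the image of `dφ`. -/
def tangentialPart (φ : N → M) (V : Π x : M, TangentSpace 𝓘(ℝ, E) x) (x : N) :
    TangentSpace 𝓘(ℝ, F) x :=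
  LinearMap.adjoint (mfderiv 𝓘(ℝ, F) 𝓘(ℝ, E) φ x : TangentSpace 𝓘(ℝ, F) x →ₗ[ℝ]
    TangentSpace 𝓘(ℝ, E) (φ x)) (V (φ x))

/-- The unit tangential component `T = V^⊤ / |V^⊤|` of `V`. -/
def unitTangentialPart (φ : N → M) (V : Π x : M, TangentSpace 𝓘(ℝ, E) x) (x : N) :
    TangentSpace 𝓘(ℝ, F) x :=
  ‖tangentialPart (E := E) (F := F) φ V x‖⁻¹ • tangentialPart (E := E) (F := F) φ V x

/-- The hypersurface `φ : N → M` with unit normal `U` is a constant angle hypersurface with unit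
anti-torqued axis `V` and angle `θ`. -/
structure IsConstantAngleHypersurface (φ : N → M) (U : Π x : N, TangentSpace 𝓘(ℝ, E) (φ x))
    (V : Π x : M, TangentSpace 𝓘(ℝ, E) x) (θ : ℝ) : Prop where
  codim_one : Module.finrank ℝ E = Module.finrank ℝ F + 1
  isometric : IsIsometricImmersion (E := E) (F := F) φ
  normal : IsUnitNormal (E := E) (F := F) φ U
  axis : IsAntiTorqued V
  axis_unit : ∀ x, ‖V x‖ = 1
  tangential_ne_zero : ∀ x, tangentialPart (E := E) (F := F) φ V x ≠ 0
  angle_mem : θ ∈ Icc 0 Real.pi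
  angle : ∀ x, ⟪U x, V (φ x)⟫_ℝ = Real.cos θ

/-- `φ : N → M` is ruled: `N` is foliated by curves which `φ` maps to geodesics of `M`.  The
foliation is given by its field `L` of tangent lines, which is locally spanned by smooth unit vector
fields `Z`. -/
def IsRuled (φ : N → M) : Prop :=
  ∃ L : Π x : N, Submodule ℝ (TangentSpace 𝓘(ℝ, F) x),
    ∀ p : N, ∃ (W : Set N) (Z : Π x : N, TangentSpace 𝓘(ℝ, F) x),
      IsOpen W ∧ p ∈ W ∧
      ContMDiffOn 𝓘(ℝ, F) 𝓘(ℝ, F).tangent ∞ (fun x ↦ (⟨x, Z x⟩ : TangentBundle 𝓘(ℝ, F) N)) W ∧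
      (∀ x ∈ W, ‖Z x‖ = 1 ∧ L x = Submodule.span ℝ {Z x}) ∧
      ∀ (γ : ℝ → N) (s : Set ℝ), IsOpen s → MapsTo γ s W → IsMIntegralCurveOn γ Z s →
        IsGeodesicOn (E := E) (φ ∘ γ) s

end Hypersurface

end ConstantAngle

end

open ConstantAngle

/-! Everything rests on one fact: the 1-form dual to `V` is closed. Its exterior derivative is the
antisymmetrization of `∇V`, and the anti-torqued equation gives `⟪∇ᵤV, w⟫ = f⟪u, w⟫ - f⟪V, u⟫⟪V,
w⟫`, which is symmetric in `u` and `w` (`inner_leviCivita_sub`,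
`IsAntiTorqued.fderiv_chartCovector_flat_symm`). Pulling back along `φ` keeps the form closed and
turns it into the dual of `V^⊤`. The constant angle makes `|V^⊤|² = 1 - cos² θ` constant, so the
dual of `T` is a constant multiple of a closed form and is closed too.

A unit field with closed dual satisfies `⟪∇_T T, w⟫ = ⟪∇_w T, T⟫ = 0`, so its integral curves are
geodesics (`leviCivita_self_eq_zero`). Its orthogonal complement is the kernel of a closed nowhere
vanishing form, so it is integrable: the leaves are level sets of a local primitive
(`exists_straightening`, `isIntegrable_ker`). This gives the splitting for every `θ`.

If `cos θ = 0`, then `V` is tangent to `N` and `dφ T = V`. Since `∇_V V = fV - f|V|²V = 0`, `φ` maps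
the integral curves of `T` to integral curves of `V`, which are geodesics of `M`. -/

noncomputable section

namespace ConstantAngle

/-! ### Frames, coframes and covector fields in the preferred charts -/

section Charts

variable {E : Type*} [NormedAddCommGroup E] [NormedSpace ℝ E]
  {M : Type*} [TopologicalSpace M] [ChartedSpace E M]

theorem extChartAt_symm_mem_source {x : M} {y : E} (hy : y ∈ (extChartAt 𝓘(ℝ, E) x).target) :
    (extChartAt 𝓘(ℝ, E) x).symm y ∈ (chartAt E x).source := by
  rw [← extChartAt_source 𝓘(ℝ, E)]
  exact (extChartAt 𝓘(ℝ, E) x).map_target hy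

variable [IsManifold 𝓘(ℝ, E) ∞ M]

/-- The frame of the tangent bundle over the preferred chart at `x`, evaluated at `q`. -/
def frameAt (x q : M) : E →L[ℝ] TangentSpace 𝓘(ℝ, E) q :=
  (trivializationAt E (TangentSpace 𝓘(ℝ, E) : M → Type _) x).symmL ℝ q

/-- The components of a tangent vector at `q` in the preferred chart at `x`. -/
def coframeAt (x q : M) : TangentSpace 𝓘(ℝ, E) q →L[ℝ] E :=
  (trivializationAt E (TangentSpace 𝓘(ℝ, E) : M → Type _) x).continuousLinearMapAt ℝ q

theorem chartField_eq (Y : Π x : M, TangentSpace 𝓘(ℝ, E) x) (x : M) (y : E) :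
    chartField Y x y =
      coframeAt x ((extChartAt 𝓘(ℝ, E) x).symm y) (Y ((extChartAt 𝓘(ℝ, E) x).symm y)) :=
  rfl

theorem coframeAt_frameAt {x q : M} (hq : q ∈ (chartAt E x).source) (v : E) :
    coframeAt x q (frameAt x q v) = v :=
  (trivializationAt E (TangentSpace 𝓘(ℝ, E) : M → Type _) x).continuousLinearMapAt_symmL
    (R := ℝ) hq v

theorem frameAt_coframeAt {x q : M} (hq : q ∈ (chartAt E x).source)
    (v : TangentSpace 𝓘(ℝ, E) q) : frameAt x q (coframeAt x q v) = v :=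
  (trivializationAt E (TangentSpace 𝓘(ℝ, E) : M → Type _) x).symmL_continuousLinearMapAt
    (R := ℝ) hq v

theorem coframeAt_eq_mfderiv {x q : M} (hq : q ∈ (chartAt E x).source) :
    coframeAt x q = mfderiv 𝓘(ℝ, E) 𝓘(ℝ, E) (extChartAt 𝓘(ℝ, E) x) q :=
  TangentBundle.continuousLinearMapAt_trivializationAt hq

theorem frameAt_eq_mfderiv {x q : M} (hq : q ∈ (chartAt E x).source) :
    frameAt (E := E) x q = mfderiv 𝓘(ℝ, E) 𝓘(ℝ, E) (extChartAt 𝓘(ℝ, E) x).symm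
      (extChartAt 𝓘(ℝ, E) x q) := by
  have := TangentBundle.symmL_trivializationAt (I := 𝓘(ℝ, E)) hq
  rw [ModelWithCorners.range_eq_univ, mfderivWithin_univ] at this
  exact this

/-- Justifies identifying `TangentSpace 𝓘(ℝ, E) x` with `E`, as the definitions of `leviCivita` and
`christoffel` do: at its own centre the preferred chart has identity derivative. -/
theorem coframeAt_self (x : M) : coframeAt x x = ContinuousLinearMap.id ℝ E := by
  rw [coframeAt_eq_mfderiv (mem_chart_source E x)]
  exact mfderiv_extChartAt_self

theorem frameAt_self (x : M) : frameAt x x = ContinuousLinearMap.id ℝ E := by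
  rw [frameAt_eq_mfderiv (mem_chart_source E x)]
  have := mfderivWithin_range_extChartAt_symm (I := 𝓘(ℝ, E)) (x := x)
  rwa [ModelWithCorners.range_eq_univ, mfderivWithin_univ] at this

theorem contMDiffOn_frameAt (x : M) (w : E) :
    ContMDiffOn 𝓘(ℝ, E) 𝓘(ℝ, E).tangent ∞
      (fun q ↦ (⟨q, frameAt x q w⟩ : TangentBundle 𝓘(ℝ, E) M)) (chartAt E x).source := by
  refine ((trivializationAt E (TangentSpace 𝓘(ℝ, E) : M → Type _)
    x).contMDiffOn_section_baseSet_iff (IB := 𝓘(ℝ, E)) (n := ∞)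
    (s := fun q ↦ frameAt x q w)).2 ?_
  refine (contMDiffOn_const (c := w)).congr fun q hq ↦ ?_
  have h := coframeAt_frameAt (x := x) hq w
  rwa [coframeAt, Trivialization.continuousLinearMapAt_apply_of_mem ℝ _ hq] at h

theorem contDiffOn_chartField {Y : Π x : M, TangentSpace 𝓘(ℝ, E) x}
    (hY : ContMDiff 𝓘(ℝ, E) 𝓘(ℝ, E).tangent ∞ (fun x ↦ (⟨x, Y x⟩ : TangentBundle 𝓘(ℝ, E) M)))
    (x : M) : ContDiffOn ℝ ∞ (chartField Y x) (extChartAt 𝓘(ℝ, E) x).target := by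
  have h1 := ((trivializationAt E (TangentSpace 𝓘(ℝ, E) : M → Type _)
    x).contMDiffOn_section_baseSet_iff (IB := 𝓘(ℝ, E)) (n := ∞) (s := Y)).1 hY.contMDiffOn
  have h2 := h1.comp (contMDiffOn_extChartAt_symm (n := ∞) (I := 𝓘(ℝ, E)) x)
    (fun y hy ↦ extChartAt_symm_mem_source hy)
  exact (contMDiffOn_iff_contDiffOn.1 h2).congr fun y hy ↦
    Trivialization.continuousLinearMapAt_apply_of_mem ℝ _ (extChartAt_symm_mem_source hy) _

theorem contMDiffAt_of_contDiffAt_chartField {Y : Π x : M, TangentSpace 𝓘(ℝ, E) x} {x : M}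
    (hY : ContDiffAt ℝ ∞ (chartField Y x) (extChartAt 𝓘(ℝ, E) x x)) :
    ContMDiffAt 𝓘(ℝ, E) 𝓘(ℝ, E).tangent ∞
      (fun x ↦ (⟨x, Y x⟩ : TangentBundle 𝓘(ℝ, E) M)) x := by
  refine ((trivializationAt E (TangentSpace 𝓘(ℝ, E) : M → Type _)
    x).contMDiffAt_section_iff (IB := 𝓘(ℝ, E)) (n := ∞) (s := Y) (mem_chart_source E x)).2 ?_
  have h := hY.contMDiffAt.comp x (contMDiffAt_extChartAt (I := 𝓘(ℝ, E)) (x := x) (n := ∞))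
  refine h.congr_of_eventuallyEq ?_
  filter_upwards [(chartAt E x).open_source.mem_nhds (mem_chart_source E x)] with q hq
  have hq' : (extChartAt 𝓘(ℝ, E) x).symm (extChartAt 𝓘(ℝ, E) x q) = q :=
    (extChartAt 𝓘(ℝ, E) x).left_inv (by rwa [extChartAt_source])
  simp only [Function.comp_apply, chartField]
  rw [hq', Trivialization.continuousLinearMapAt_apply_of_mem ℝ _ hq]

/-- The components of the covector field `α` in the preferred chart at `x`, as a function of the
coordinates. -/
def chartCovector (α : Π x : M, TangentSpace 𝓘(ℝ, E) x →L[ℝ] ℝ) (x : M) (y : E) : E →L[ℝ] ℝ :=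
  (α ((extChartAt 𝓘(ℝ, E) x).symm y)).comp (frameAt x ((extChartAt 𝓘(ℝ, E) x).symm y))

theorem chartCovector_extChartAt (α : Π x : M, TangentSpace 𝓘(ℝ, E) x →L[ℝ] ℝ) {x q : M}
    (hq : q ∈ (chartAt E x).source) :
    chartCovector α x (extChartAt 𝓘(ℝ, E) x q) = (α q).comp (frameAt x q) := by
  have hq' : (extChartAt 𝓘(ℝ, E) x).symm (extChartAt 𝓘(ℝ, E) x q) = q :=
    (extChartAt 𝓘(ℝ, E) x).left_inv (by rwa [extChartAt_source])
  simp only [chartCovector]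
  rw [hq']

/-- A covector field is smooth and closed: its components in the preferred charts are smooth with
symmetric derivative. -/
def IsSmoothClosed (α : Π x : M, TangentSpace 𝓘(ℝ, E) x →L[ℝ] ℝ) : Prop :=
  ∀ x : M, ∀ y ∈ (extChartAt 𝓘(ℝ, E) x).target, ContDiffAt ℝ ∞ (chartCovector α x) y ∧
    ∀ u v, fderiv ℝ (chartCovector α x) y u v = fderiv ℝ (chartCovector α x) y v u

end Charts

/-! ### Pullback of covector fields and of closedness -/

section Pullback

variable {E : Type*} [NormedAddCommGroup E] [NormedSpace ℝ E]
  {M : Type*} [TopologicalSpace M] [ChartedSpace E M] [IsManifold 𝓘(ℝ, E) ∞ M]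
  {F : Type*} [NormedAddCommGroup F] [NormedSpace ℝ F]
  {N : Type*} [TopologicalSpace N] [ChartedSpace F N] [IsManifold 𝓘(ℝ, F) ∞ N]

/-- The pullback of a covector field. -/
def pullbackCovector (φ : N → M) (α : Π x : M, TangentSpace 𝓘(ℝ, E) x →L[ℝ] ℝ) (x : N) :
    TangentSpace 𝓘(ℝ, F) x →L[ℝ] ℝ :=
  (α (φ x)).comp (mfderiv 𝓘(ℝ, F) 𝓘(ℝ, E) φ x)

theorem contDiffAt_extChartAt_comp {φ : N → M} (hφ : ContMDiff 𝓘(ℝ, F) 𝓘(ℝ, E) ∞ φ) (p : N) (x : M)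
    {y : F} (hy : y ∈ (extChartAt 𝓘(ℝ, F) p).target)
    (hx : φ ((extChartAt 𝓘(ℝ, F) p).symm y) ∈ (chartAt E x).source) :
    ContDiffAt ℝ ∞ (extChartAt 𝓘(ℝ, E) x ∘ φ ∘ (extChartAt 𝓘(ℝ, F) p).symm) y := by
  rw [← contMDiffAt_iff_contDiffAt]
  refine (contMDiffAt_extChartAt' hx).comp y (hφ.contMDiffAt.comp y ?_)
  exact (contMDiffOn_extChartAt_symm p).contMDiffAt
    ((isOpen_extChartAt_target (I := 𝓘(ℝ, F)) p).mem_nhds hy)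

theorem fderiv_extChartAt_comp {φ : N → M} (hφ : ContMDiff 𝓘(ℝ, F) 𝓘(ℝ, E) ∞ φ) (p : N) (x : M)
    {y : F} (hy : y ∈ (extChartAt 𝓘(ℝ, F) p).target)
    (hx : φ ((extChartAt 𝓘(ℝ, F) p).symm y) ∈ (chartAt E x).source) :
    fderiv ℝ (extChartAt 𝓘(ℝ, E) x ∘ φ ∘ (extChartAt 𝓘(ℝ, F) p).symm) y =
      (coframeAt x (φ ((extChartAt 𝓘(ℝ, F) p).symm y))).comp
        ((mfderiv 𝓘(ℝ, F) 𝓘(ℝ, E) φ ((extChartAt 𝓘(ℝ, F) p).symm y)).comp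
          (frameAt p ((extChartAt 𝓘(ℝ, F) p).symm y))) := by
  rw [← mfderiv_eq_fderiv, coframeAt_eq_mfderiv hx,
    frameAt_eq_mfderiv (extChartAt_symm_mem_source hy), (extChartAt 𝓘(ℝ, F) p).right_inv hy]
  have h1 : MDifferentiableAt 𝓘(ℝ, F) 𝓘(ℝ, F) (extChartAt 𝓘(ℝ, F) p).symm y :=
    ((contMDiffOn_extChartAt_symm (n := ∞) p).contMDiffAt
      ((isOpen_extChartAt_target (I := 𝓘(ℝ, F)) p).mem_nhds hy)).mdifferentiableAt (by simp)
  have h2 : MDifferentiableAt 𝓘(ℝ, F) 𝓘(ℝ, E) φ ((extChartAt 𝓘(ℝ, F) p).symm y) :=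
    hφ.contMDiffAt.mdifferentiableAt (by simp)
  have h3 : MDifferentiableAt 𝓘(ℝ, E) 𝓘(ℝ, E) (extChartAt 𝓘(ℝ, E) x)
      (φ ((extChartAt 𝓘(ℝ, F) p).symm y)) := mdifferentiableAt_extChartAt hx
  have h4 := mfderiv_comp y h3 (h2.comp y h1)
  rw [mfderiv_comp y h2 h1] at h4
  exact h4

/-- The chain rule, with the frame and coframe of the chart at `x` cancelling. It reduces pullback
between manifolds to pullback between vector spaces. -/
theorem chartCovector_pullbackCovector {φ : N → M} (hφ : ContMDiff 𝓘(ℝ, F) 𝓘(ℝ, E) ∞ φ)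
    (α : Π x : M, TangentSpace 𝓘(ℝ, E) x →L[ℝ] ℝ) (p : N) (x : M)
    {y : F} (hy : y ∈ (extChartAt 𝓘(ℝ, F) p).target)
    (hx : φ ((extChartAt 𝓘(ℝ, F) p).symm y) ∈ (chartAt E x).source) :
    chartCovector (pullbackCovector φ α) p y =
      (chartCovector α x ((extChartAt 𝓘(ℝ, E) x ∘ φ ∘ (extChartAt 𝓘(ℝ, F) p).symm) y)).comp
        (fderiv ℝ (extChartAt 𝓘(ℝ, E) x ∘ φ ∘ (extChartAt 𝓘(ℝ, F) p).symm) y) := by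
  rw [fderiv_extChartAt_comp hφ p x hy hx]
  simp only [Function.comp_apply]
  rw [chartCovector_extChartAt α hx]
  ext w
  simp only [chartCovector, pullbackCovector, ContinuousLinearMap.comp_apply]
  rw [frameAt_coframeAt hx]

/-- The pullback of a closed form in a vector space is closed. -/
theorem fderiv_pullback_symm {β : E → E →L[ℝ] ℝ} {ψ : F → E} {y : F}
    (hβ : DifferentiableAt ℝ β (ψ y)) (hψ : ContDiffAt ℝ ∞ ψ y)
    (hsymm : ∀ u v, fderiv ℝ β (ψ y) u v = fderiv ℝ β (ψ y) v u) (u v : F) :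
    fderiv ℝ (fun z ↦ (β (ψ z)).comp (fderiv ℝ ψ z)) y u v =
      fderiv ℝ (fun z ↦ (β (ψ z)).comp (fderiv ℝ ψ z)) y v u := by
  have hψ1 : HasFDerivAt ψ (fderiv ℝ ψ y) y := (hψ.differentiableAt (by simp)).hasFDerivAt
  have hψ2 : HasFDerivAt (fderiv ℝ ψ) (fderiv ℝ (fderiv ℝ ψ) y) y :=
    ((hψ.fderiv_right (m := ∞) (by simp)).differentiableAt (by simp)).hasFDerivAt
  have h := (hβ.hasFDerivAt.comp y hψ1).clm_comp hψ2
  -- Differentiating the pullback produces `Dβ(Dψ u, Dψ v)` and `β(D²ψ(u, v))`; the second term is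
  -- symmetric by equality of mixed partials.
  have hs : IsSymmSndFDerivAt ℝ ψ y := 
    hψ.isSymmSndFDerivAt
      (by simp only [minSmoothness_of_isRCLikeNormedField]; exact ENat.LEInfty.out)
  simp only [Function.comp_def] at h
  rw [h.fderiv]
  simp [hsymm _ (fderiv ℝ ψ y u), hs.eq u v]

/-- The pullback of a covector field which is smooth and closed at the centres of the preferred
charts is smooth and closed. -/
theorem isSmoothClosed_pullbackCovector {φ : N → M} (hφ : ContMDiff 𝓘(ℝ, F) 𝓘(ℝ, E) ∞ φ)
    {α : Π x : M, TangentSpace 𝓘(ℝ, E) x →L[ℝ] ℝ}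
    (hα : ∀ x : M, ContDiffAt ℝ ∞ (chartCovector α x) (extChartAt 𝓘(ℝ, E) x x))
    (hsymm : ∀ (x : M) (u v : E),
      fderiv ℝ (chartCovector α x) (extChartAt 𝓘(ℝ, E) x x) u v =
        fderiv ℝ (chartCovector α x) (extChartAt 𝓘(ℝ, E) x x) v u) :
    IsSmoothClosed (pullbackCovector (F := F) φ α) := by
  intro p y hy
  -- The chart on `M` is recentred at the image of the point under study, so that information at the
  -- centres of charts suffices.
  set x := φ ((extChartAt 𝓘(ℝ, F) p).symm y) with hx
  set ψ := extChartAt 𝓘(ℝ, E) x ∘ φ ∘ (extChartAt 𝓘(ℝ, F) p).symm with hψ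
  have hxs : φ ((extChartAt 𝓘(ℝ, F) p).symm y) ∈ (chartAt E x).source := mem_chart_source E x
  have hψy : ψ y = extChartAt 𝓘(ℝ, E) x x := rfl
  have hψs : ContDiffAt ℝ ∞ ψ y := contDiffAt_extChartAt_comp hφ p x hy hxs
  have hev : chartCovector (pullbackCovector φ α) p =ᶠ[𝓝 y]
      fun z ↦ (chartCovector α x (ψ z)).comp (fderiv ℝ ψ z) := by
    have hc : ContinuousAt (φ ∘ (extChartAt 𝓘(ℝ, F) p).symm) y :=
      hφ.continuous.continuousAt.comp (continuousAt_extChartAt_symm'' hy)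
    filter_upwards [(isOpen_extChartAt_target (I := 𝓘(ℝ, F)) p).mem_nhds hy,
      hc.preimage_mem_nhds ((chartAt E x).open_source.mem_nhds hxs)] with z hz hz'
    exact chartCovector_pullbackCovector hφ α p x hz hz'
  refine ⟨?_, fun u v ↦ ?_⟩
  · refine ContDiffAt.congr_of_eventuallyEq ?_ hev
    exact ((hα x).comp y hψs).clm_comp (hψs.fderiv_right (by simp))
  · rw [hev.fderiv_eq]
    exact fderiv_pullback_symm (ψ := ψ) (β := chartCovector α x)
      ((hα x).differentiableAt (by simp)) hψs (hsymm x) u v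

end Pullback

/-! ### Linear algebra behind the Christoffel symbols -/

section Trilinear

variable {E : Type*} [NormedAddCommGroup E] [NormedSpace ℝ E]

theorem antisymmetrized_add (B : E →L[ℝ] E →L[ℝ] E →L[ℝ] ℝ) (u v w w' : E) :
    (B u v (w + w') + B v u (w + w') - B (w + w') u v) / 2 =
      (B u v w + B v u w - B w u v) / 2 + (B u v w' + B v u w' - B w' u v) / 2 := by
  rw [(B u v).map_add, (B v u).map_add, B.map_add, add_apply, add_apply]
  ring

theorem antisymmetrized_smul (B : E →L[ℝ] E →L[ℝ] E →L[ℝ] ℝ) (u v : E) (c : ℝ) (w : E) :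
    (B u v (c • w) + B v u (c • w) - B (c • w) u v) / 2 =
      c • ((B u v w + B v u w - B w u v) / 2) := by
  rw [(B u v).map_smul, (B v u).map_smul, B.map_smul, smul_apply, smul_apply]
  simp only [smul_eq_mul]
  ring

end Trilinear

/-- The Riesz representative of a linear functional in terms of an orthonormal basis. -/
theorem inner_sum_smul_orthonormalBasis {ι T : Type*} [Fintype ι] [NormedAddCommGroup T]
    [InnerProductSpace ℝ T] (b : OrthonormalBasis ι ℝ T) (ℓ : T →ₗ[ℝ] ℝ) (w : T) :
    ⟪∑ i, ℓ (b i) • b i, w⟫_ℝ = ℓ w := by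
  conv_rhs => rw [← b.sum_repr' w]
  simp only [map_sum, map_smul, sum_inner, real_inner_smul_left, smul_eq_mul]
  exact Finset.sum_congr rfl fun i _ ↦ mul_comm _ _

/-! ### Vector fields at the centre of a chart, and their dual forms -/

section Fields

variable {E : Type*} [NormedAddCommGroup E] [NormedSpace ℝ E]
  {M : Type*} [TopologicalSpace M] [ChartedSpace E M]

/-- The 1-form dual to a vector field. -/
def flat [RiemannianBundle (fun x : M ↦ TangentSpace 𝓘(ℝ, E) x)]
    (V : Π x : M, TangentSpace 𝓘(ℝ, E) x) (x : M) : TangentSpace 𝓘(ℝ, E) x →L[ℝ] ℝ :=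
  innerSL ℝ (V x)

variable [IsManifold 𝓘(ℝ, E) ∞ M]

theorem frameAt_self_apply (x : M) (u : E) :
    frameAt x x u = (show TangentSpace 𝓘(ℝ, E) x from u) :=
  DFunLike.congr_fun (frameAt_self x) u

theorem coframeAt_self_apply (x : M) (u : TangentSpace 𝓘(ℝ, E) x) :
    coframeAt x x u = (show E from u) :=
  DFunLike.congr_fun (coframeAt_self x) u

theorem chartField_self (Y : Π x : M, TangentSpace 𝓘(ℝ, E) x) (x : M) :
    chartField Y x (extChartAt 𝓘(ℝ, E) x x) = Y x := by
  rw [chartField_eq, extChartAt_to_inv x, coframeAt_self]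
  rfl

theorem frameAt_chartField (Y : Π x : M, TangentSpace 𝓘(ℝ, E) x) (x : M) :
    frameAt x x (chartField Y x (extChartAt 𝓘(ℝ, E) x x)) = Y x := by
  rw [chartField_eq, extChartAt_to_inv x, frameAt_coframeAt (mem_chart_source E x)]

theorem contDiffAt_chartField {V : Π x : M, TangentSpace 𝓘(ℝ, E) x}
    (hV : ContMDiff 𝓘(ℝ, E) 𝓘(ℝ, E).tangent ∞ (fun x ↦ (⟨x, V x⟩ : TangentBundle 𝓘(ℝ, E) M)))
    (x : M) {y : E} (hy : y ∈ (extChartAt 𝓘(ℝ, E) x).target) :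
    ContDiffAt ℝ ∞ (chartField V x) y :=
  (contDiffOn_chartField hV x).contDiffAt
    ((isOpen_extChartAt_target (I := 𝓘(ℝ, E)) x).mem_nhds hy)

end Fields

/-! ### The metric and the Levi-Civita derivative in coordinates -/

section Metric

variable {E : Type*} [NormedAddCommGroup E] [NormedSpace ℝ E]
  {M : Type*} [TopologicalSpace M] [ChartedSpace E M] [IsManifold 𝓘(ℝ, E) ∞ M]
  [RiemannianBundle (fun x : M ↦ TangentSpace 𝓘(ℝ, E) x)]

/-- The components of the Riemannian metric in the preferred chart at `x`, as a function of the
coordinates with values in the continuous bilinear forms. -/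
def chartMetricL (x : M) (y : E) : E →L[ℝ] E →L[ℝ] ℝ :=
  (innerSL ℝ : TangentSpace 𝓘(ℝ, E) ((extChartAt 𝓘(ℝ, E) x).symm y) →L[ℝ] _).bilinearComp
    (frameAt x ((extChartAt 𝓘(ℝ, E) x).symm y)) (frameAt x ((extChartAt 𝓘(ℝ, E) x).symm y))

theorem chartMetricL_apply (x : M) (y v w : E) :
    chartMetricL x y v w = ⟪frameAt x ((extChartAt 𝓘(ℝ, E) x).symm y) v,
      frameAt x ((extChartAt 𝓘(ℝ, E) x).symm y) w⟫_ℝ :=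
  rfl

theorem chartMetric_eq_chartMetricL (x : M) (y v w : E) :
    chartMetric x y v w = chartMetricL x y v w :=
  rfl

theorem chartMetricL_symm (x : M) (y v w : E) : chartMetricL x y v w = chartMetricL x y w v := by
  rw [chartMetricL_apply, chartMetricL_apply, real_inner_comm]

theorem chartMetricL_self (x : M) (v w : E) :
    chartMetricL x (extChartAt 𝓘(ℝ, E) x x) v w = ⟪frameAt x x v, frameAt x x w⟫_ℝ := by
  rw [chartMetricL_apply, extChartAt_to_inv x]

theorem chartCovector_flat (V : Π x : M, TangentSpace 𝓘(ℝ, E) x) (x : M) {y : E}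
    (hy : y ∈ (extChartAt 𝓘(ℝ, E) x).target) :
    chartCovector (flat V) x y = chartMetricL x y (chartField V x y) := by
  ext w
  rw [chartMetricL_apply, chartField_eq, frameAt_coframeAt (extChartAt_symm_mem_source hy)]
  rfl

theorem chartCovector_flat_eventuallyEq (V : Π x : M, TangentSpace 𝓘(ℝ, E) x) (x : M) :
    chartCovector (flat V) x =ᶠ[𝓝 (extChartAt 𝓘(ℝ, E) x x)]
      fun y ↦ chartMetricL x y (chartField V x y) := by
  filter_upwards [extChartAt_target_mem_nhds (I := 𝓘(ℝ, E)) x] with y hy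
  exact chartCovector_flat V x hy

theorem chartMetricL_chartField_self (V : Π x : M, TangentSpace 𝓘(ℝ, E) x) (x : M) {y : E}
    (hy : y ∈ (extChartAt 𝓘(ℝ, E) x).target) :
    chartMetricL x y (chartField V x y) (chartField V x y) =
      ‖V ((extChartAt 𝓘(ℝ, E) x).symm y)‖ ^ 2 := by
  rw [chartMetricL_apply, chartField_eq, frameAt_coframeAt (extChartAt_symm_mem_source hy),
    real_inner_self_eq_norm_sq]

theorem contMDiffOn_inner
    [IsContMDiffRiemannianBundle 𝓘(ℝ, E) ∞ E (fun x : M ↦ TangentSpace 𝓘(ℝ, E) x)]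
    {v w : Π x : M, TangentSpace 𝓘(ℝ, E) x} {s : Set M}
    (hv : ContMDiffOn 𝓘(ℝ, E) 𝓘(ℝ, E).tangent ∞
      (fun x ↦ (⟨x, v x⟩ : TangentBundle 𝓘(ℝ, E) M)) s)
    (hw : ContMDiffOn 𝓘(ℝ, E) 𝓘(ℝ, E).tangent ∞
      (fun x ↦ (⟨x, w x⟩ : TangentBundle 𝓘(ℝ, E) M)) s) :
    ContMDiffOn 𝓘(ℝ, E) 𝓘(ℝ, ℝ) ∞ (fun x ↦ ⟪v x, w x⟫_ℝ) s :=
  ContMDiffOn.inner_bundle (IB := 𝓘(ℝ, E)) (F := E) (E := fun x : M ↦ TangentSpace 𝓘(ℝ, E) x)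
    (b := fun q : M ↦ q) (v := v) (w := w) hv hw

variable [FiniteDimensional ℝ E]

theorem leviCivita_frameAt (V : Π x : M, TangentSpace 𝓘(ℝ, E) x) (x : M) (u : E) :
    leviCivita V x (frameAt x x u) =
      frameAt x x (fderiv ℝ (chartField V x) (extChartAt 𝓘(ℝ, E) x x) u) +
        christoffel x (frameAt x x u) (V x) := by
  have h : leviCivita V x (frameAt x x u) =
      leviCivita V x (show TangentSpace 𝓘(ℝ, E) x from u) :=
    congrArg (leviCivita V x) (frameAt_self_apply x u)
  refine h.trans (congrArg₂ (· + ·) (frameAt_self_apply x _).symm ?_)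
  exact congrArg (fun z ↦ christoffel x z (V x)) (frameAt_self_apply x u).symm

variable
  [IsContMDiffRiemannianBundle 𝓘(ℝ, E) ∞ E (fun x : M ↦ TangentSpace 𝓘(ℝ, E) x)]

theorem contDiffOn_chartMetricL (x : M) :
    ContDiffOn ℝ ∞ (chartMetricL x) (extChartAt 𝓘(ℝ, E) x).target := by
  refine contDiffOn_clm_apply.2 fun v ↦ contDiffOn_clm_apply.2 fun w ↦ ?_
  have h := (contMDiffOn_inner (contMDiffOn_frameAt x v) (contMDiffOn_frameAt x w)).comp
    (contMDiffOn_extChartAt_symm (n := ∞) (I := 𝓘(ℝ, E)) x)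
    (fun y hy ↦ extChartAt_symm_mem_source hy)
  exact contMDiffOn_iff_contDiffOn.1 h

theorem contDiffAt_chartMetricL (x : M) {y : E} (hy : y ∈ (extChartAt 𝓘(ℝ, E) x).target) :
    ContDiffAt ℝ ∞ (chartMetricL x) y :=
  (contDiffOn_chartMetricL x).contDiffAt ((isOpen_extChartAt_target (I := 𝓘(ℝ, E)) x).mem_nhds hy)

theorem differentiableAt_chartMetricL (x : M) :
    DifferentiableAt ℝ (chartMetricL x) (extChartAt 𝓘(ℝ, E) x x) :=
  (contDiffAt_chartMetricL x (mem_extChartAt_target x)).differentiableAt (by simp)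

theorem fderiv_chartMetric (x : M) (u v w : E) :
    fderiv ℝ (fun z ↦ chartMetric x z v w) (extChartAt 𝓘(ℝ, E) x x) u =
      fderiv ℝ (chartMetricL x) (extChartAt 𝓘(ℝ, E) x x) u v w := by
  have h := (((differentiableAt_chartMetricL x).hasFDerivAt.clm_apply
    (hasFDerivAt_const v _)).clm_apply (hasFDerivAt_const w _)).fderiv
  simp only [chartMetric_eq_chartMetricL]
  rw [h]
  simp

theorem fderiv_chartMetricL_symm (x : M) (u v w : E) :
    fderiv ℝ (chartMetricL x) (extChartAt 𝓘(ℝ, E) x x) u v w =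
      fderiv ℝ (chartMetricL x) (extChartAt 𝓘(ℝ, E) x x) u w v := by
  rw [← fderiv_chartMetric, ← fderiv_chartMetric]
  simp only [chartMetric_eq_chartMetricL, chartMetricL_symm x _ v w]

theorem christoffelFirst_chartMetric (x : M) (u v w : E) :
    christoffelFirst (chartMetric x) (extChartAt 𝓘(ℝ, E) x x) u v w =
      (fderiv ℝ (chartMetricL x) (extChartAt 𝓘(ℝ, E) x x) u v w +
        fderiv ℝ (chartMetricL x) (extChartAt 𝓘(ℝ, E) x x) v u w -
        fderiv ℝ (chartMetricL x) (extChartAt 𝓘(ℝ, E) x x) w u v) / 2 := by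
  simp only [christoffelFirst]
  rw [fderiv_chartMetric, fderiv_chartMetric, fderiv_chartMetric]

theorem christoffelFirst_add_right (x : M) (u v w w' : E) :
    christoffelFirst (chartMetric x) (extChartAt 𝓘(ℝ, E) x x) u v (w + w') =
      christoffelFirst (chartMetric x) (extChartAt 𝓘(ℝ, E) x x) u v w +
      christoffelFirst (chartMetric x) (extChartAt 𝓘(ℝ, E) x x) u v w' := by
  rw [christoffelFirst_chartMetric, christoffelFirst_chartMetric, christoffelFirst_chartMetric,
    antisymmetrized_add]

theorem christoffelFirst_smul_right (x : M) (u v : E) (c : ℝ) (w : E) :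
    christoffelFirst (chartMetric x) (extChartAt 𝓘(ℝ, E) x x) u v (c • w) =
      c • christoffelFirst (chartMetric x) (extChartAt 𝓘(ℝ, E) x x) u v w := by
  rw [christoffelFirst_chartMetric, christoffelFirst_chartMetric, antisymmetrized_smul]

/-- The orthonormal-basis sum defining `christoffel` is a Riesz representative, because the symbol
of the first kind is linear in its last slot. From here on the basis plays no role. -/
theorem inner_christoffel (x : M) (u v w : TangentSpace 𝓘(ℝ, E) x) :
    ⟪christoffel x u v, w⟫_ℝ =
      christoffelFirst (chartMetric x) (extChartAt 𝓘(ℝ, E) x x) u v w := by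
  let ℓ : E →ₗ[ℝ] ℝ :=
    { toFun := fun w ↦ christoffelFirst (chartMetric x) (extChartAt 𝓘(ℝ, E) x x) u v w
      map_add' := christoffelFirst_add_right (E := E) x u v
      map_smul' := christoffelFirst_smul_right (E := E) x u v }
  have hℓ (z : TangentSpace 𝓘(ℝ, E) x) : (ℓ ∘ₗ (coframeAt x x).toLinearMap) z =
      christoffelFirst (chartMetric x) (extChartAt 𝓘(ℝ, E) x x) u v z :=
    congrArg ℓ (coframeAt_self_apply x z)
  have hb := inner_sum_smul_orthonormalBasis (stdOrthonormalBasis ℝ (TangentSpace 𝓘(ℝ, E) x))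
    (ℓ ∘ₗ (coframeAt x x).toLinearMap) w
  simp only [hℓ] at hb
  exact hb

theorem inner_leviCivita (V : Π x : M, TangentSpace 𝓘(ℝ, E) x) (x : M) (u w : E) :
    ⟪leviCivita V x (frameAt x x u), frameAt x x w⟫_ℝ = chartMetricL x (extChartAt 𝓘(ℝ, E) x x)
        (fderiv ℝ (chartField V x) (extChartAt 𝓘(ℝ, E) x x) u) w +
      (fderiv ℝ (chartMetricL x) (extChartAt 𝓘(ℝ, E) x x) u
          (chartField V x (extChartAt 𝓘(ℝ, E) x x)) w +
        fderiv ℝ (chartMetricL x) (extChartAt 𝓘(ℝ, E) x x)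
          (chartField V x (extChartAt 𝓘(ℝ, E) x x)) u w -
        fderiv ℝ (chartMetricL x) (extChartAt 𝓘(ℝ, E) x x) w u
          (chartField V x (extChartAt 𝓘(ℝ, E) x x))) / 2 := by
  rw [leviCivita_frameAt, inner_add_left, ← chartMetricL_self, inner_christoffel,
    ← christoffelFirst_chartMetric]
  refine congrArg _ ?_
  exact congr (congr (congrArg (christoffelFirst (chartMetric x) (extChartAt 𝓘(ℝ, E) x x))
    (frameAt_self_apply x u)) (chartField_self V x).symm) (frameAt_self_apply x w)

section Smooth

variable {V : Π x : M, TangentSpace 𝓘(ℝ, E) x}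
theorem contDiffAt_chartCovector_flat
    (hV : ContMDiff 𝓘(ℝ, E) 𝓘(ℝ, E).tangent ∞ (fun x ↦ (⟨x, V x⟩ : TangentBundle 𝓘(ℝ, E) M)))
    (x : M) :
    ContDiffAt ℝ ∞ (chartCovector (flat V) x) (extChartAt 𝓘(ℝ, E) x x) :=
  ((contDiffAt_chartMetricL x (mem_extChartAt_target x)).clm_apply
    (contDiffAt_chartField hV x (mem_extChartAt_target x))).congr_of_eventuallyEq
    (chartCovector_flat_eventuallyEq V x)

theorem fderiv_chartCovector_flat
    (hV : ContMDiff 𝓘(ℝ, E) 𝓘(ℝ, E).tangent ∞ (fun x ↦ (⟨x, V x⟩ : TangentBundle 𝓘(ℝ, E) M)))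
    (x : M) (u w : E) :
    fderiv ℝ (chartCovector (flat V) x) (extChartAt 𝓘(ℝ, E) x x) u w =
      fderiv ℝ (chartMetricL x) (extChartAt 𝓘(ℝ, E) x x) u
        (chartField V x (extChartAt 𝓘(ℝ, E) x x)) w +
      chartMetricL x (extChartAt 𝓘(ℝ, E) x x)
        (fderiv ℝ (chartField V x) (extChartAt 𝓘(ℝ, E) x x) u) w := by
  have hY := ((contDiffAt_chartField hV x (mem_extChartAt_target x)).differentiableAt
    (by simp)).hasFDerivAt
  rw [(chartCovector_flat_eventuallyEq V x).fderiv_eq,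
    ((differentiableAt_chartMetricL x).hasFDerivAt.clm_apply hY).fderiv]
  simp only [add_apply, ContinuousLinearMap.comp_apply, ContinuousLinearMap.flip_apply]
  ring

/-- The exterior derivative of the dual form of `V` is the antisymmetrization of `∇V`. -/
theorem inner_leviCivita_sub
    (hV : ContMDiff 𝓘(ℝ, E) 𝓘(ℝ, E).tangent ∞ (fun x ↦ (⟨x, V x⟩ : TangentBundle 𝓘(ℝ, E) M)))
    (x : M) (u w : E) :
    ⟪leviCivita V x (frameAt x x u), frameAt x x w⟫_ℝ -
        ⟪leviCivita V x (frameAt x x w), frameAt x x u⟫_ℝ =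
      fderiv ℝ (chartCovector (flat V) x) (extChartAt 𝓘(ℝ, E) x x) u w -
        fderiv ℝ (chartCovector (flat V) x) (extChartAt 𝓘(ℝ, E) x x) w u := by
  rw [inner_leviCivita, inner_leviCivita, fderiv_chartCovector_flat hV,
    fderiv_chartCovector_flat hV, fderiv_chartMetricL_symm x w u,
    fderiv_chartMetricL_symm x _ w u, fderiv_chartMetricL_symm x u w]
  ring

/-- The covariant derivative of a unit vector field is orthogonal to it. -/
theorem inner_leviCivita_self_of_norm_eq_one
    (hV : ContMDiff 𝓘(ℝ, E) 𝓘(ℝ, E).tangent ∞ (fun x ↦ (⟨x, V x⟩ : TangentBundle 𝓘(ℝ, E) M)))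
    (h1 : ∀ x, ‖V x‖ = 1) (x : M) (w : E) :
    ⟪leviCivita V x (frameAt x x w), V x⟫_ℝ = 0 := by
  have hY := ((contDiffAt_chartField hV x (mem_extChartAt_target x)).differentiableAt
    (by simp)).hasFDerivAt
  -- Differentiate the identity `g(V, V) = 1` in coordinates.
  have hev : (fun y ↦ chartMetricL x y (chartField V x y) (chartField V x y))
      =ᶠ[𝓝 (extChartAt 𝓘(ℝ, E) x x)] fun _ ↦ (1 : ℝ) := by
    filter_upwards [extChartAt_target_mem_nhds (I := 𝓘(ℝ, E)) x] with y hy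
    rw [chartMetricL_chartField_self V x hy, h1, one_pow]
  have h2 := (((differentiableAt_chartMetricL x).hasFDerivAt.clm_apply hY).clm_apply hY).fderiv
  rw [hev.fderiv_eq] at h2
  have h3 := congrArg (fun ℓ : E →L[ℝ] ℝ ↦ ℓ w) h2
  simp only [fderiv_const_apply, zero_apply, add_apply, ContinuousLinearMap.comp_apply,
    ContinuousLinearMap.flip_apply] at h3
  rw [chartMetricL_symm] at h3
  rw [← frameAt_chartField V x, inner_leviCivita, fderiv_chartMetricL_symm x _ w]
  linarith

/-- The integral curves of a unit vector field with closed dual form are geodesics. -/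
theorem leviCivita_self_eq_zero
    (hV : ContMDiff 𝓘(ℝ, E) 𝓘(ℝ, E).tangent ∞ (fun x ↦ (⟨x, V x⟩ : TangentBundle 𝓘(ℝ, E) M)))
    (h1 : ∀ x, ‖V x‖ = 1) (x : M)
    (hsymm : ∀ u v, fderiv ℝ (chartCovector (flat V) x) (extChartAt 𝓘(ℝ, E) x x) u v =
      fderiv ℝ (chartCovector (flat V) x) (extChartAt 𝓘(ℝ, E) x x) v u) :
    leviCivita V x (V x) = 0 := by
  refine ext_inner_right ℝ fun w ↦ ?_
  obtain ⟨w, rfl⟩ : ∃ w', frameAt x x w' = w :=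
    ⟨coframeAt x x w, frameAt_coframeAt (mem_chart_source E x) w⟩
  -- Closedness swaps the slots: `⟪∇_V V, w⟫ = ⟪∇_w V, V⟫`, which vanishes because `|V| = 1`.
  have h := inner_leviCivita_sub hV x (chartField V x (extChartAt 𝓘(ℝ, E) x x)) w
  rw [hsymm, sub_self, frameAt_chartField, inner_leviCivita_self_of_norm_eq_one hV h1,
    sub_zero] at h
  rw [h, inner_zero_left]

end Smooth

end Metric

/-! ### Integral curves: regularity and acceleration -/

section IntegralCurves

/-- Solutions of a smooth autonomous differential equation are smooth. -/
theorem contDiffOn_of_hasDerivAt_comp {E : Type*} [NormedAddCommGroup E] [NormedSpace ℝ E]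
    {c : ℝ → E} {Y : E → E} {O : Set E} {s : Set ℝ} (hs : IsOpen s) (hY : ContDiffOn ℝ ∞ Y O)
    (hcO : MapsTo c s O) (hc : ∀ t ∈ s, HasDerivAt c (Y (c t)) t) : ContDiffOn ℝ ∞ c s := by
  refine contDiffOn_infty.2 fun n ↦ ?_
  -- Bootstrapping: `c' = Y ∘ c` is as regular as `c`, so `c` gains one derivative at each step.
  induction n with
  | zero => exact contDiffOn_zero.2 fun t ht ↦ (hc t ht).continuousAt.continuousWithinAt
  | succ n ih =>
    rw [Nat.cast_add, Nat.cast_one, contDiffOn_succ_iff_deriv_of_isOpen hs]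
    refine ⟨fun t ht ↦ (hc t ht).differentiableAt.differentiableWithinAt, by simp, ?_⟩
    exact ((contDiffOn_infty.1 hY n).comp ih hcO).congr fun t ht ↦ (hc t ht).deriv

variable {E : Type*} [NormedAddCommGroup E] [NormedSpace ℝ E]
  {M : Type*} [TopologicalSpace M] [ChartedSpace E M] [IsManifold 𝓘(ℝ, E) ∞ M]
  {V : Π x : M, TangentSpace 𝓘(ℝ, E) x}

theorem chartField_extChartAt (V : Π x : M, TangentSpace 𝓘(ℝ, E) x) {x q : M}
    (hq : q ∈ (chartAt E x).source) :
    chartField V x (extChartAt 𝓘(ℝ, E) x q) = coframeAt x q (V q) := by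
  have hq' : (extChartAt 𝓘(ℝ, E) x).symm (extChartAt 𝓘(ℝ, E) x q) = q :=
    (extChartAt 𝓘(ℝ, E) x).left_inv (by rwa [extChartAt_source])
  rw [chartField_eq, hq']

/-- In the preferred chart an integral curve solves the differential equation of the components of
the vector field. -/
theorem eventually_hasDerivAt_extChartAt_comp {γ : ℝ → M} {t₀ : ℝ}
    (hγ : IsMIntegralCurveAt γ V t₀) :
    ∀ᶠ t in 𝓝 t₀, γ t ∈ (chartAt E (γ t₀)).source ∧
      HasDerivAt (extChartAt 𝓘(ℝ, E) (γ t₀) ∘ γ)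
        (chartField V (γ t₀) ((extChartAt 𝓘(ℝ, E) (γ t₀) ∘ γ) t)) t := by
  filter_upwards [hγ.eventually_hasDerivAt, hγ.continuousAt.preimage_mem_nhds
    ((chartAt E (γ t₀)).open_source.mem_nhds (mem_chart_source E (γ t₀)))] with t ht hts
  refine ⟨hts, ?_⟩
  rw [Function.comp_apply, chartField_extChartAt V hts]
  have h := TangentBundle.continuousLinearMapAt_trivializationAt_eq_core (I := 𝓘(ℝ, E)) hts
  have h' : coframeAt (γ t₀) (γ t) (V (γ t)) =
      tangentCoordChange 𝓘(ℝ, E) (γ t) (γ t₀) (γ t) (V (γ t)) := DFunLike.congr_fun h (V (γ t))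
  rw [h']
  exact ht

/-- Supplies the smoothness demanded by `IsGeodesicOn`; an integral curve is a priori only
differentiable. -/
theorem contMDiffAt_of_isMIntegralCurveAt
    (hV : ContMDiff 𝓘(ℝ, E) 𝓘(ℝ, E).tangent ∞ (fun x ↦ (⟨x, V x⟩ : TangentBundle 𝓘(ℝ, E) M)))
    {γ : ℝ → M} {t₀ : ℝ}
    (hγ : IsMIntegralCurveAt γ V t₀) : ContMDiffAt 𝓘(ℝ, ℝ) 𝓘(ℝ, E) ∞ γ t₀ := by
  obtain ⟨s, hs, hso, ht₀⟩ := eventually_nhds_iff.1 (eventually_hasDerivAt_extChartAt_comp hγ)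
  have hmaps : MapsTo (extChartAt 𝓘(ℝ, E) (γ t₀) ∘ γ) s (extChartAt 𝓘(ℝ, E) (γ t₀)).target :=
    fun t ht ↦ (extChartAt 𝓘(ℝ, E) (γ t₀)).map_source
      (by rw [extChartAt_source]; exact (hs t ht).1)
  have hc := contDiffOn_of_hasDerivAt_comp hso (contDiffOn_chartField hV (γ t₀)) hmaps
    fun t ht ↦ (hs t ht).2
  have h := ((contMDiffOn_extChartAt_symm (n := ∞) (I := 𝓘(ℝ, E)) (γ t₀)).comp
    (contMDiffOn_iff_contDiffOn.2 hc) hmaps).contMDiffAt (hso.mem_nhds ht₀)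
  refine h.congr_of_eventuallyEq ?_
  filter_upwards [hso.mem_nhds ht₀] with t ht
  exact ((extChartAt 𝓘(ℝ, E) (γ t₀)).left_inv
    (by rw [extChartAt_source]; exact (hs t ht).1)).symm

variable [RiemannianBundle (fun x : M ↦ TangentSpace 𝓘(ℝ, E) x)] [FiniteDimensional ℝ E]

/-- The covariant acceleration of an integral curve of `V` is `∇_V V`. -/
theorem covariantAcceleration_of_isMIntegralCurveAt
    (hV : ContMDiff 𝓘(ℝ, E) 𝓘(ℝ, E).tangent ∞ (fun x ↦ (⟨x, V x⟩ : TangentBundle 𝓘(ℝ, E) M)))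
    {γ : ℝ → M} {t₀ : ℝ}
    (hγ : IsMIntegralCurveAt γ V t₀) :
    covariantAcceleration (E := E) γ t₀ = leviCivita V (γ t₀) (V (γ t₀)) := by
  have hev := eventually_hasDerivAt_extChartAt_comp hγ
  set c : ℝ → E := fun s ↦ extChartAt 𝓘(ℝ, E) (γ t₀) (γ s) with hc
  have hY : HasFDerivAt (chartField V (γ t₀))
      (fderiv ℝ (chartField V (γ t₀)) (c t₀)) (c t₀) :=
    ((contDiffAt_chartField hV (γ t₀) (mem_extChartAt_target (γ t₀))).differentiableAt
      (by simp)).hasFDerivAt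
  have hd : deriv c t₀ = V (γ t₀) :=
    hev.self_of_nhds.2.deriv.trans (chartField_self V (γ t₀))
  -- Differentiating `c' = Y ∘ c` gives `c'' = DY(c)(c')`, the derivative term of `∇_V V`.
  have hdd : deriv (deriv c) t₀ = fderiv ℝ (chartField V (γ t₀)) (c t₀) (V (γ t₀)) := by
    have h1 : deriv c =ᶠ[𝓝 t₀] chartField V (γ t₀) ∘ c := by
      filter_upwards [hev] with t ht
      exact ht.2.deriv
    rw [h1.deriv_eq]
    have h2 := (hY.comp_hasDerivAt t₀ hev.self_of_nhds.2).deriv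
    refine h2.trans (congrArg _ (chartField_self V (γ t₀)))
  exact congrArg₂ (· + ·) hdd (congrArg₂ (christoffel (γ t₀)) hd hd)

/-- If `∇_V V = 0`, then the integral curves of `V` are geodesics. -/
theorem isGeodesicOn_of_isMIntegralCurveOn
    (hV : ContMDiff 𝓘(ℝ, E) 𝓘(ℝ, E).tangent ∞ (fun x ↦ (⟨x, V x⟩ : TangentBundle 𝓘(ℝ, E) M)))
    (h0 : ∀ x, leviCivita V x (V x) = 0) {γ : ℝ → M}
    {s : Set ℝ} (hs : IsOpen s) (hγ : IsMIntegralCurveOn γ V s) : IsGeodesicOn (E := E) γ s := by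
  have hat : ∀ t ∈ s, IsMIntegralCurveAt γ V t := fun t ht ↦
    hγ.isMIntegralCurveAt (hs.mem_nhds ht)
  refine ⟨fun t ht ↦ (contMDiffAt_of_isMIntegralCurveAt hV (hat t ht)).contMDiffWithinAt,
    fun t ht ↦ ?_⟩
  rw [covariantAcceleration_of_isMIntegralCurveAt hV (hat t ht), h0]

end IntegralCurves

/-! ### Integrability of the kernel of a closed 1-form -/

section Integrability

/-- Near a point where a closed 1-form on a vector space does not vanish, some local diffeomorphism
turns it into a constant form. -/
theorem exists_straightening {F : Type*} [NormedAddCommGroup F] [NormedSpace ℝ F]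
    [FiniteDimensional ℝ F] {β : F → F →L[ℝ] ℝ} {O : Set F} (hO : IsOpen O) {y₀ : F} (hy₀ : y₀ ∈ O)
    (hβ : ContDiffOn ℝ ∞ β O) (hsymm : ∀ y ∈ O, ∀ u v, fderiv ℝ β y u v = fderiv ℝ β y v u)
    (hne : β y₀ ≠ 0) :
    ∃ P : OpenPartialHomeomorph F F, y₀ ∈ P.source ∧ P.source ⊆ O ∧ P y₀ = y₀ ∧
      ∀ y ∈ P.source, ContDiffAt ℝ ∞ P.symm (P y) ∧
        ∃ A : F ≃L[ℝ] F, HasFDerivAt P.symm (A.symm : F →L[ℝ] F) (P y) ∧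
          ∀ a, β y₀ (A a) = β y a := by
  obtain ⟨r, hr, hrO⟩ := Metric.isOpen_iff.1 hO y₀ hy₀
  set B := Metric.ball y₀ r with hB
  have hBo : IsOpen B := Metric.isOpen_ball
  have hyB : y₀ ∈ B := Metric.mem_ball_self hr
  have hβB : ContDiffOn ℝ ∞ β B := hβ.mono hrO
  -- Poincaré lemma on a ball: `h` is a primitive of `β`.
  obtain ⟨h, hh⟩ := (convex_ball y₀ r).exists_forall_hasFDerivAt_of_fderiv_symmetric hBo
    (hβB.differentiableOn (by simp)) fun y hy ↦ hsymm y (hrO hy)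
  obtain ⟨e, he⟩ : ∃ e, β y₀ e = 1 := by
    obtain ⟨v, hv⟩ : ∃ v, β y₀ v ≠ 0 := by
      by_contra! hcon
      exact hne (ContinuousLinearMap.ext hcon)
    exact ⟨(β y₀ v)⁻¹ • v, by simp [hv]⟩
  have hhs : ContDiffOn ℝ ∞ h B := by
    rw [contDiffOn_infty_iff_fderiv_of_isOpen hBo]
    exact ⟨fun y hy ↦ (hh y hy).differentiableAt.differentiableWithinAt,
      hβB.congr fun y hy ↦ (hh y hy).fderiv⟩
  -- The nonlinear remainder of `h` is added along `e`. As `β y₀ e = 1`, the map `β y₀ ∘ Φ` equals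
  -- `h` up to a constant, and `Φ` has identity derivative at `y₀`.
  let Φ : F → F := fun y ↦ y + (h y - h y₀ - β y₀ (y - y₀)) • e
  let dΦ : F → F →L[ℝ] F := fun y ↦ ContinuousLinearMap.id ℝ F + (β y - β y₀).smulRight e
  have hΦs : ContDiffOn ℝ ∞ Φ B := by
    refine contDiffOn_id.add (ContDiffOn.smul ((hhs.sub contDiffOn_const).sub ?_) contDiffOn_const)
    exact (β y₀).contDiff.comp_contDiffOn (contDiffOn_id.sub contDiffOn_const)
  have hdΦ : ∀ y ∈ B, HasFDerivAt Φ (dΦ y) y := fun y hy ↦ by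
    refine (hasFDerivAt_id y).add (HasFDerivAt.smul_const ?_ e)
    refine ((hh y hy).sub_const (h y₀)).sub ?_
    exact (β y₀).hasFDerivAt.comp y ((hasFDerivAt_id y).sub_const y₀)
  have hdΦ₀ : dΦ y₀ = ((ContinuousLinearEquiv.refl ℝ F : F ≃L[ℝ] F) : F →L[ℝ] F) := by
    ext a
    simp [dΦ]
  have hdΦc : ContinuousAt dΦ y₀ := by
    have hc : ContinuousAt β y₀ := hβB.continuousOn.continuousAt (hBo.mem_nhds hyB)
    refine continuousAt_const.add ?_
    exact ((ContinuousLinearMap.smulRightL ℝ F F).flip e).continuous.continuousAt.comp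
      (hc.sub continuousAt_const)
  -- Invertibility is an open condition. It is needed on a neighbourhood, since the inverse must be
  -- smooth at every point of the leaf and not only at `P y₀`.
  have hinv : ∀ᶠ y in 𝓝 y₀, y ∈ B ∧ dΦ y ∈ range ((↑) : (F ≃L[ℝ] F) → F →L[ℝ] F) := by
    refine Filter.Eventually.and (hBo.mem_nhds hyB) (hdΦc.preimage_mem_nhds ?_)
    exact ContinuousLinearEquiv.isOpen.mem_nhds ⟨_, hdΦ₀.symm⟩
  obtain ⟨S, hS, hSo, hyS⟩ := eventually_nhds_iff.1 hinv
  have hΦat : ContDiffAt ℝ ∞ Φ y₀ := hΦs.contDiffAt (hBo.mem_nhds hyB)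
  have hΦd : HasFDerivAt Φ ((ContinuousLinearEquiv.refl ℝ F : F ≃L[ℝ] F) : F →L[ℝ] F) y₀ :=
    hdΦ₀ ▸ hdΦ y₀ hyB
  set Q := hΦat.toOpenPartialHomeomorph Φ hΦd (by simp) with hQ
  have hQy : y₀ ∈ Q.source := hΦat.mem_toOpenPartialHomeomorph_source hΦd (by simp)
  refine ⟨Q.restrOpen S hSo, ⟨hQy, hyS⟩, fun y hy ↦ hrO (hS y hy.2).1, ?_, fun y hy ↦ ?_⟩
  · change Φ y₀ = y₀
    simp [Φ]
  · obtain ⟨hyB', A, hA⟩ := hS y hy.2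
    have hd : HasFDerivAt Q (A : F →L[ℝ] F) y := hA ▸ hdΦ y hyB'
    have hmem : Q y ∈ Q.target := Q.map_source hy.1
    have hd' : HasFDerivAt Q (A : F →L[ℝ] F) (Q.symm (Q y)) := by rwa [Q.left_inv hy.1]
    refine ⟨Q.contDiffAt_symm hmem hd' ?_, A, Q.hasFDerivAt_symm hmem hd', fun a ↦ ?_⟩
    · change ContDiffAt ℝ ∞ Q (Q.symm (Q y))
      rw [Q.left_inv hy.1]
      exact hΦs.contDiffAt (hBo.mem_nhds hyB')
    · have hAa : A a = dΦ y a := by rw [← hA]; rfl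
      rw [hAa]
      simp [dΦ, he]

variable {F : Type*} [NormedAddCommGroup F] [NormedSpace ℝ F] [FiniteDimensional ℝ F]
  {N : Type*} [TopologicalSpace N] [ChartedSpace F N] [IsManifold 𝓘(ℝ, F) ∞ N]

/-- The kernel of a smooth closed nowhere vanishing 1-form is integrable. -/
theorem isIntegrable_ker {α : Π x : N, TangentSpace 𝓘(ℝ, F) x →L[ℝ] ℝ} (hα : IsSmoothClosed α)
    (hne : ∀ x, α x ≠ 0) : IsIntegrable (fun x ↦ (α x).ker) := by
  intro p
  have hO := isOpen_extChartAt_target (I := 𝓘(ℝ, F)) p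
  set y₀ := extChartAt 𝓘(ℝ, F) p p with hy₀
  have hβ₀ : chartCovector α p y₀ ≠ 0 := by
    intro h0
    rw [hy₀, chartCovector_extChartAt α (mem_chart_source F p)] at h0
    refine hne p (ContinuousLinearMap.ext fun w ↦ ?_)
    have := DFunLike.congr_fun h0 (coframeAt p p w)
    rwa [ContinuousLinearMap.comp_apply, frameAt_coframeAt (mem_chart_source F p)] at this
  obtain ⟨P, hyP, hPO, hPy, hP⟩ := exists_straightening hO (mem_extChartAt_target p)
    (fun y hy ↦ (hα p y hy).1.contDiffWithinAt) (fun y hy ↦ (hα p y hy).2) hβ₀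
  let K : Submodule ℝ F := (chartCovector α p y₀).ker
  let J : EuclideanSpace ℝ (Fin (Module.finrank ℝ K)) →L[ℝ] F :=
    K.subtypeL.comp (toEuclidean (E := K)).symm.toContinuousLinearMap
  have hJinj : Function.Injective J :=
    Subtype.val_injective.comp (toEuclidean (E := K)).symm.injective
  have hJker (z) : chartCovector α p y₀ (J z) = 0 := ((toEuclidean (E := K)).symm z).2
  have hJrange (a : F) (ha : chartCovector α p y₀ a = 0) : ∃ z, J z = a :=
    ⟨toEuclidean (E := K) ⟨a, ha⟩, by simp [J]⟩
  -- In straightened coordinates the leaf through `p` is the affine subspace `y₀ + K`; the integral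
  -- manifold is its image under `P.symm` followed by the inverse chart.
  let j : EuclideanSpace ℝ (Fin (Module.finrank ℝ K)) → F := fun z ↦ y₀ + J z
  have hj0 : j 0 = P y₀ := by
    simp only [j, map_zero, add_zero]
    exact hPy.symm
  have hj : ContDiff ℝ ∞ j := contDiff_const.add J.contDiff
  have hjd (z) : HasFDerivAt j J z := J.hasFDerivAt.const_add y₀
  let σ : EuclideanSpace ℝ (Fin (Module.finrank ℝ K)) → F := fun z ↦ P.symm (j z)
  have hσ {z} (hz : j z ∈ P.target) : σ z ∈ P.source := P.map_target hz
  have hσt {z} (hz : j z ∈ P.target) : σ z ∈ (extChartAt 𝓘(ℝ, F) p).target := hPO (hσ hz)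
  have hPσ {z} (hz : j z ∈ P.target) : P (σ z) = j z := P.right_inv hz
  refine ⟨Module.finrank ℝ K, j ⁻¹' P.target, fun z ↦ (extChartAt 𝓘(ℝ, F) p).symm (σ z),
    P.open_target.preimage hj.continuous, ⟨0, ?_, ?_⟩, ?_, ?_, ?_⟩
  · rw [mem_preimage, hj0]
    exact P.map_source hyP
  · have h0 : σ 0 = y₀ := by
      simp only [σ]
      rw [hj0, P.left_inv hyP]
    simp only [h0]
    exact extChartAt_to_inv p
  · intro z hz z' hz' hzz
    have h1 : σ z = σ z' := (extChartAt 𝓘(ℝ, F) p).symm.injOn (hσt hz) (hσt hz') hzz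
    have h2 : j z = j z' := by rw [← hPσ hz, ← hPσ hz', h1]
    exact hJinj (add_left_cancel h2)
  · intro z hz
    refine ContMDiffAt.contMDiffWithinAt ?_
    have h1 : ContDiffAt ℝ ∞ σ z := by
      have := (hP _ (hσ hz)).1
      rw [hPσ hz] at this
      exact this.comp z hj.contDiffAt
    exact ((contMDiffOn_extChartAt_symm p).contMDiffAt (hO.mem_nhds (hσt hz))).comp z
      h1.contMDiffAt
  · intro z hz
    obtain ⟨-, A, hA, hAβ⟩ := hP _ (hσ hz)
    rw [hPσ hz] at hA
    have hσd : HasFDerivAt σ ((A.symm : F →L[ℝ] F).comp J) z := hA.comp z (hjd z)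
    have hq := extChartAt_symm_mem_source (hσt hz)
    set q := (extChartAt 𝓘(ℝ, F) p).symm (σ z) with hqdef
    have hmd : mfderiv 𝓘(ℝ, EuclideanSpace ℝ (Fin (Module.finrank ℝ K))) 𝓘(ℝ, F)
        (fun z ↦ (extChartAt 𝓘(ℝ, F) p).symm (σ z)) z =
        (frameAt p q).comp ((A.symm : F →L[ℝ] F).comp J) := by
      have h1 : MDifferentiableAt 𝓘(ℝ, F) 𝓘(ℝ, F) (extChartAt 𝓘(ℝ, F) p).symm (σ z) :=
        ((contMDiffOn_extChartAt_symm (n := ∞) p).contMDiffAt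
          (hO.mem_nhds (hσt hz))).mdifferentiableAt (by simp)
      have h2 := mfderiv_comp z h1 hσd.hasMFDerivAt.mdifferentiableAt
      rw [hσd.hasMFDerivAt.mfderiv] at h2
      rw [frameAt_eq_mfderiv hq, hqdef, (extChartAt 𝓘(ℝ, F) p).right_inv (hσt hz)]
      exact h2
    -- `A` carries the kernel of the form at `q`, read in the chart, onto the fixed kernel `K`.
    have hform (a : F) : α q (frameAt p q a) = chartCovector α p y₀ (A a) := (hAβ a).symm
    rw [hmd]
    refine ⟨fun a b hab ↦ ?_, ?_⟩
    · have h1 : A.symm (J a) = A.symm (J b) := by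
        have := congrArg (coframeAt p q) hab
        exact ((coframeAt_frameAt hq _).symm.trans this).trans (coframeAt_frameAt hq _)
      exact hJinj (A.symm.injective h1)
    · ext w
      constructor
      · rintro ⟨a, rfl⟩
        change α q (frameAt p q (A.symm (J a))) = 0
        rw [hform, A.apply_symm_apply]
        exact hJker a
      · intro hw
        have hw' : α q w = 0 := hw
        rw [← frameAt_coframeAt hq w, hform] at hw'
        obtain ⟨a, ha⟩ := hJrange _ hw'
        refine ⟨a, ?_⟩
        change frameAt p q (A.symm (J a)) = w
        rw [ha, A.symm_apply_apply, frameAt_coframeAt hq]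

end Integrability

/-! ### Tangential and normal components along a hyperplane -/

section LinearAlgebra

variable {X Y : Type*} [NormedAddCommGroup X] [InnerProductSpace ℝ X] [FiniteDimensional ℝ X]
  [NormedAddCommGroup Y] [InnerProductSpace ℝ Y] [FiniteDimensional ℝ Y]

/-- The decomposition of a vector into its components tangent and normal to a hyperplane, which is
given as the range of an isometric linear map. -/
theorem map_adjoint_add_normal {L : X →ₗ[ℝ] Y} (hL : ∀ u v, ⟪L u, L v⟫_ℝ = ⟪u, v⟫_ℝ)
    (hdim : Module.finrank ℝ Y = Module.finrank ℝ X + 1) {ν : Y} (hν : ‖ν‖ = 1)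
    (hort : ∀ w, ⟪ν, L w⟫_ℝ = 0) (v : Y) :
    L (LinearMap.adjoint L v) + ⟪ν, v⟫_ℝ • ν = v := by
  have hinj : Function.Injective L := by
    refine (injective_iff_map_eq_zero L).2 fun u hu ↦ ?_
    have := hL u u
    rw [hu, inner_zero_left] at this
    exact inner_self_eq_zero.1 this.symm
  have hν0 : ν ≠ 0 := fun h ↦ by simp [h] at hν
  have hdisj : L.range ⊓ Submodule.span ℝ {ν} = ⊥ := by
    rw [Submodule.eq_bot_iff]
    rintro z ⟨⟨w, rfl⟩, hz⟩
    obtain ⟨c, hc⟩ := Submodule.mem_span_singleton.1 hz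
    have h1 : ⟪L w, L w⟫_ℝ = 0 := by
      nth_rewrite 1 [← hc]
      rw [real_inner_smul_left, hort, mul_zero]
    exact inner_self_eq_zero.1 h1
  have htop : L.range ⊔ Submodule.span ℝ {ν} = ⊤ := by
    -- Codimension one enters here: the range of `L` and the line of `ν` are independent and fill
    -- `Y` by dimension.
    refine Submodule.eq_top_of_finrank_eq ?_
    have h1 := Submodule.finrank_sup_add_finrank_inf_eq L.range (Submodule.span ℝ {ν})
    rw [hdisj, finrank_bot, add_zero, LinearMap.finrank_range_of_inj hinj,
      finrank_span_singleton hν0] at h1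
    rw [h1, hdim]
  have hνν : ⟪ν, ν⟫_ℝ = 1 := by rw [real_inner_self_eq_norm_sq, hν, one_pow]
  refine ext_inner_left ℝ fun z ↦ ?_
  have hz : z ∈ L.range ⊔ Submodule.span ℝ {ν} := htop ▸ Submodule.mem_top
  obtain ⟨_, ⟨w, rfl⟩, _, hb, rfl⟩ := Submodule.mem_sup.1 hz
  obtain ⟨c, rfl⟩ := Submodule.mem_span_singleton.1 hb
  have h1 : ⟪L w, ν⟫_ℝ = 0 := by rw [real_inner_comm, hort]
  simp only [inner_add_left, inner_add_right, real_inner_smul_left, real_inner_smul_right, hL,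
    LinearMap.adjoint_inner_right, hort, h1, hνν]
  ring

theorem norm_adjoint_sq {L : X →ₗ[ℝ] Y} (hL : ∀ u v, ⟪L u, L v⟫_ℝ = ⟪u, v⟫_ℝ)
    (hdim : Module.finrank ℝ Y = Module.finrank ℝ X + 1) {ν : Y} (hν : ‖ν‖ = 1)
    (hort : ∀ w, ⟪ν, L w⟫_ℝ = 0) (v : Y) :
    ‖LinearMap.adjoint L v‖ ^ 2 = ‖v‖ ^ 2 - ⟪ν, v⟫_ℝ ^ 2 := by
  have h := congrArg (fun z ↦ ⟪z, v⟫_ℝ) (map_adjoint_add_normal hL hdim hν hort v)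
  simp only [inner_add_left, real_inner_smul_left] at h
  rw [← LinearMap.adjoint_inner_right, real_inner_self_eq_norm_sq,
    real_inner_self_eq_norm_sq] at h
  linarith

end LinearAlgebra

/-! ### Recovering a smooth field from its dual form -/

section Sharp

/-- Solutions of smoothly varying invertible linear equations vary smoothly. -/
theorem contDiffAt_of_clm_apply {E : Type*} [NormedAddCommGroup E] [NormedSpace ℝ E]
    [FiniteDimensional ℝ E] {G : E → E →L[ℝ] E →L[ℝ] ℝ} {β : E → E →L[ℝ] ℝ} {c : E → E} {y₀ : E}
    (hG : ContDiffAt ℝ ∞ G y₀) (hβ : ContDiffAt ℝ ∞ β y₀)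
    (hinj : ∀ᶠ y in 𝓝 y₀, Function.Injective (G y)) (hc : ∀ᶠ y in 𝓝 y₀, G y (c y) = β y) :
    ContDiffAt ℝ ∞ c y₀ := by
  have hdim : Module.finrank ℝ E = Module.finrank ℝ (E →L[ℝ] ℝ) := by
    rw [← (LinearMap.toContinuousLinearMap (𝕜 := ℝ) (E := E) (F' := ℝ)).finrank_eq]
    exact (Subspace.dual_finrank_eq (K := ℝ) (V := E)).symm
  have hequiv {y : E} (hy : Function.Injective (G y)) :
      ∃ e : E ≃L[ℝ] (E →L[ℝ] ℝ), (e : E →L[ℝ] E →L[ℝ] ℝ) = G y :=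
    ⟨(LinearEquiv.ofInjectiveOfFinrankEq (G y).toLinearMap hy hdim).toContinuousLinearEquiv, rfl⟩
  obtain ⟨e₀, he₀⟩ := hequiv hinj.self_of_nhds
  -- Inversion of continuous linear maps is smooth at an isomorphism, and near `y₀` one has `c = G⁻¹
  -- β`.
  have hinv : ContDiffAt ℝ ∞ (fun y ↦ (G y).inverse) y₀ := by
    have h := contDiffAt_map_inverse (𝕜 := ℝ) (n := ∞) e₀
    rw [he₀] at h
    exact h.comp y₀ hG
  refine (hinv.clm_apply hβ).congr_of_eventuallyEq ?_
  filter_upwards [hinj, hc] with y hy hcy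
  obtain ⟨e, he⟩ := hequiv hy
  rw [← hcy, ← he, ContinuousLinearMap.inverse_equiv]
  exact (e.symm_apply_apply (c y)).symm

variable {E : Type*} [NormedAddCommGroup E] [NormedSpace ℝ E]
  {M : Type*} [TopologicalSpace M] [ChartedSpace E M] [IsManifold 𝓘(ℝ, E) ∞ M]

theorem IsSmoothClosed.const_smul {α : Π x : M, TangentSpace 𝓘(ℝ, E) x →L[ℝ] ℝ}
    (hα : IsSmoothClosed α) (c : ℝ) : IsSmoothClosed (fun x ↦ c • α x) := by
  intro x y hy
  have h : chartCovector (fun x ↦ c • α x) x = fun y ↦ c • chartCovector α x y := by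
    funext y
    rfl
  obtain ⟨hs, hsymm⟩ := hα x y hy
  rw [h]
  refine ⟨hs.const_smul c, fun u v ↦ ?_⟩
  rw [fderiv_fun_const_smul (hs.differentiableAt (by simp))]
  exact congrArg (c * ·) (hsymm u v)

variable [RiemannianBundle (fun x : M ↦ TangentSpace 𝓘(ℝ, E) x)] [FiniteDimensional ℝ E]
  [IsContMDiffRiemannianBundle 𝓘(ℝ, E) ∞ E (fun x : M ↦ TangentSpace 𝓘(ℝ, E) x)]

/-- Raising the index: the metric is smooth and nondegenerate. This yields smoothness of `T`, which
is defined by a pointwise adjoint. -/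
theorem contMDiff_of_isSmoothClosed_flat {V : Π x : M, TangentSpace 𝓘(ℝ, E) x}
    (hV : IsSmoothClosed (flat V)) :
    ContMDiff 𝓘(ℝ, E) 𝓘(ℝ, E).tangent ∞ (fun x ↦ (⟨x, V x⟩ : TangentBundle 𝓘(ℝ, E) M)) := by
  intro x
  refine contMDiffAt_of_contDiffAt_chartField ?_
  refine contDiffAt_of_clm_apply (contDiffAt_chartMetricL x (mem_extChartAt_target x))
    (hV x _ (mem_extChartAt_target x)).1 ?_ ?_
  · filter_upwards [extChartAt_target_mem_nhds (I := 𝓘(ℝ, E)) x] with y hy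
    refine (injective_iff_map_eq_zero (chartMetricL x y)).2 fun v hv ↦ ?_
    have h1 := DFunLike.congr_fun hv v
    rw [chartMetricL_apply] at h1
    have h2 := inner_self_eq_zero.1 h1
    rw [← coframeAt_frameAt (extChartAt_symm_mem_source hy) v, h2, map_zero]
  · filter_upwards [extChartAt_target_mem_nhds (I := 𝓘(ℝ, E)) x] with y hy
    exact (chartCovector_flat V x hy).symm

end Sharp

/-! ### Constant angle hypersurfaces -/

section Hypersurface

variable {E : Type*} [NormedAddCommGroup E] [NormedSpace ℝ E] [FiniteDimensional ℝ E]
  {M : Type*} [TopologicalSpace M] [ChartedSpace E M]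
  [RiemannianBundle (fun x : M ↦ TangentSpace 𝓘(ℝ, E) x)]
  {F : Type*} [NormedAddCommGroup F] [NormedSpace ℝ F] [FiniteDimensional ℝ F]
  {N : Type*} [TopologicalSpace N] [ChartedSpace F N]
  [RiemannianBundle (fun x : N ↦ TangentSpace 𝓘(ℝ, F) x)]

theorem pullbackCovector_flat (φ : N → M) (V : Π x : M, TangentSpace 𝓘(ℝ, E) x) (x : N) :
    pullbackCovector (F := F) φ (flat V) x = flat (tangentialPart (E := E) (F := F) φ V) x := by
  ext w
  exact (LinearMap.adjoint_inner_left (mfderiv 𝓘(ℝ, F) 𝓘(ℝ, E) φ x :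
    TangentSpace 𝓘(ℝ, F) x →ₗ[ℝ] TangentSpace 𝓘(ℝ, E) (φ x)) w (V (φ x))).symm

variable [IsManifold 𝓘(ℝ, E) ∞ M]

/-- An anti-torqued unit vector field is geodesic. -/
theorem IsAntiTorqued.leviCivita_self {V : Π x : M, TangentSpace 𝓘(ℝ, E) x}
    (hV : IsAntiTorqued V) (h1 : ∀ x, ‖V x‖ = 1) (x : M) : leviCivita V x (V x) = 0 := by
  obtain ⟨-, f, -, -, hf⟩ := hV
  rw [hf x (V x)]
  have : (-f x • innerSL ℝ (V x)) (V x) = -f x := by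
    change -f x * ⟪V x, V x⟫_ℝ = -f x
    rw [real_inner_self_eq_norm_sq, h1]
    ring
  rw [this, neg_smul, add_neg_cancel]

section Closed

variable [IsContMDiffRiemannianBundle 𝓘(ℝ, E) ∞ E (fun x : M ↦ TangentSpace 𝓘(ℝ, E) x)]

/-- The 1-form dual to an anti-torqued vector field is closed. -/
theorem IsAntiTorqued.fderiv_chartCovector_flat_symm {V : Π x : M, TangentSpace 𝓘(ℝ, E) x}
    (hV : IsAntiTorqued V) (x : M) (u w : E) :
    fderiv ℝ (chartCovector (flat V) x) (extChartAt 𝓘(ℝ, E) x x) u w =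
      fderiv ℝ (chartCovector (flat V) x) (extChartAt 𝓘(ℝ, E) x x) w u := by
  obtain ⟨hs, f, -, -, hf⟩ := hV
  have h := inner_leviCivita_sub hs x u w
  have key (a b : TangentSpace 𝓘(ℝ, E) x) :
      ⟪leviCivita V x a, b⟫_ℝ = f x * ⟪a, b⟫_ℝ - f x * ⟪V x, a⟫_ℝ * ⟪V x, b⟫_ℝ := by
    rw [hf x a, inner_add_left, real_inner_smul_left, real_inner_smul_left]
    have : (-f x • innerSL ℝ (V x)) a = -f x * ⟪V x, a⟫_ℝ := rfl
    rw [this]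
    ring
  rw [key, key, real_inner_comm (frameAt x x w)] at h
  linarith

theorem IsAntiTorqued.isSmoothClosed_flat_tangentialPart [IsManifold 𝓘(ℝ, F) ∞ N]
    {V : Π x : M, TangentSpace 𝓘(ℝ, E) x}
    (hV : IsAntiTorqued V) {φ : N → M} (hφ : ContMDiff 𝓘(ℝ, F) 𝓘(ℝ, E) ∞ φ) :
    IsSmoothClosed (flat (tangentialPart (E := E) (F := F) φ V)) := by
  have h : flat (tangentialPart (E := E) (F := F) φ V) = pullbackCovector (F := F) φ (flat V) :=
    funext fun x ↦ (pullbackCovector_flat φ V x).symm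
  rw [h]
  exact isSmoothClosed_pullbackCovector hφ (contDiffAt_chartCovector_flat hV.1)
    hV.fderiv_chartCovector_flat_symm

end Closed

namespace IsConstantAngleHypersurface

variable {φ : N → M} {U : Π x : N, TangentSpace 𝓘(ℝ, E) (φ x)}
  {V : Π x : M, TangentSpace 𝓘(ℝ, E) x} {θ : ℝ}
theorem mfderiv_tangentialPart
    (h : IsConstantAngleHypersurface (F := F) φ U V θ) (x : N) :
    mfderiv 𝓘(ℝ, F) 𝓘(ℝ, E) φ x (tangentialPart (E := E) (F := F) φ V x) + Real.cos θ • U x =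
      V (φ x) := by
  rw [← h.angle x]
  exact map_adjoint_add_normal (L := (mfderiv 𝓘(ℝ, F) 𝓘(ℝ, E) φ x :
    TangentSpace 𝓘(ℝ, F) x →ₗ[ℝ] TangentSpace 𝓘(ℝ, E) (φ x))) (h.isometric.2 x) h.codim_one
    (h.normal.2.1 x) (h.normal.2.2 x) (V (φ x))

theorem norm_tangentialPart_sq
    (h : IsConstantAngleHypersurface (F := F) φ U V θ) (x : N) :
    ‖tangentialPart (E := E) (F := F) φ V x‖ ^ 2 = 1 - Real.cos θ ^ 2 := by
  have h1 := norm_adjoint_sq (L := (mfderiv 𝓘(ℝ, F) 𝓘(ℝ, E) φ x :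
    TangentSpace 𝓘(ℝ, F) x →ₗ[ℝ] TangentSpace 𝓘(ℝ, E) (φ x))) (h.isometric.2 x) h.codim_one
    (h.normal.2.1 x) (h.normal.2.2 x) (V (φ x))
  rw [h.angle x, h.axis_unit, one_pow] at h1
  exact h1

theorem norm_tangentialPart
    (h : IsConstantAngleHypersurface (F := F) φ U V θ) (x : N) :
    ‖tangentialPart (E := E) (F := F) φ V x‖ = Real.sqrt (1 - Real.cos θ ^ 2) := by
  rw [← h.norm_tangentialPart_sq x, Real.sqrt_sq (norm_nonneg _)]

theorem norm_unitTangentialPart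
    (h : IsConstantAngleHypersurface (F := F) φ U V θ) (x : N) :
    ‖unitTangentialPart (E := E) (F := F) φ V x‖ = 1 := by
  rw [unitTangentialPart, norm_smul, norm_inv, norm_norm,
    inv_mul_cancel₀ (norm_ne_zero_iff.2 (h.tangential_ne_zero x))]

variable [IsManifold 𝓘(ℝ, F) ∞ N]
  [IsContMDiffRiemannianBundle 𝓘(ℝ, E) ∞ E (fun x : M ↦ TangentSpace 𝓘(ℝ, E) x)]

/-- The constant angle is decisive here: normalizing `V^⊤` divides by a constant, whereas a variable
factor could destroy closedness. -/
theorem isSmoothClosed_flat_unitTangentialPart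
    (h : IsConstantAngleHypersurface (F := F) φ U V θ) :
    IsSmoothClosed (flat (unitTangentialPart (E := E) (F := F) φ V)) := by
  have heq : flat (unitTangentialPart (E := E) (F := F) φ V) =
      fun x ↦ (Real.sqrt (1 - Real.cos θ ^ 2))⁻¹ •
        flat (tangentialPart (E := E) (F := F) φ V) x := by
    funext x
    rw [flat, unitTangentialPart, h.norm_tangentialPart x, map_smul]
    rfl
  rw [heq]
  exact (h.axis.isSmoothClosed_flat_tangentialPart h.isometric.1).const_smul _

variable [IsContMDiffRiemannianBundle 𝓘(ℝ, F) ∞ F (fun x : N ↦ TangentSpace 𝓘(ℝ, F) x)]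

theorem contMDiff_unitTangentialPart
    (h : IsConstantAngleHypersurface (F := F) φ U V θ) :
    ContMDiff 𝓘(ℝ, F) 𝓘(ℝ, F).tangent ∞ (fun x ↦
      (⟨x, unitTangentialPart (E := E) (F := F) φ V x⟩ : TangentBundle 𝓘(ℝ, F) N)) :=
  contMDiff_of_isSmoothClosed_flat h.isSmoothClosed_flat_unitTangentialPart

/-- The rulings are the integral curves of `T`, a single global field. With no normal component,
`|V^⊤| = 1` and `dφ T = V`, so `φ` sends them to integral curves of the geodesic field `V`. -/
theorem isRuled
    (h : IsConstantAngleHypersurface (F := F) φ U V θ) (hcos : Real.cos θ = 0) :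
    IsRuled (E := E) (F := F) φ := by
  refine ⟨fun x ↦ Submodule.span ℝ {unitTangentialPart (E := E) (F := F) φ V x}, fun p ↦
    ⟨univ, unitTangentialPart (E := E) (F := F) φ V, isOpen_univ, mem_univ p,
      h.contMDiff_unitTangentialPart.contMDiffOn,
      fun x _ ↦ ⟨h.norm_unitTangentialPart x, rfl⟩, fun γ s hs _ hγ ↦ ?_⟩⟩
  refine isGeodesicOn_of_isMIntegralCurveOn h.axis.1 (h.axis.leviCivita_self h.axis_unit) hs ?_
  intro t ht
  have hd : mfderiv 𝓘(ℝ, F) 𝓘(ℝ, E) φ (γ t) (unitTangentialPart (E := E) (F := F) φ V (γ t)) =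
      V (φ (γ t)) := by
    have h1 := h.mfderiv_tangentialPart (γ t)
    rw [hcos, zero_smul, add_zero] at h1
    rw [unitTangentialPart, h.norm_tangentialPart, hcos]
    simpa using h1
  have hφ : HasMFDerivAt 𝓘(ℝ, F) 𝓘(ℝ, E) φ (γ t) (mfderiv 𝓘(ℝ, F) 𝓘(ℝ, E) φ (γ t)) :=
    (h.isometric.1.contMDiffAt.mdifferentiableAt (by simp)).hasMFDerivAt
  have hcomp := hφ.comp_hasMFDerivWithinAt t (hγ t ht)
  have hL : (mfderiv 𝓘(ℝ, F) 𝓘(ℝ, E) φ (γ t)).comp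
      ((1 : ℝ →L[ℝ] ℝ).smulRight (unitTangentialPart (E := E) (F := F) φ V (γ t))) =
      (1 : ℝ →L[ℝ] ℝ).smulRight (V (φ (γ t))) := by
    rw [← hd]
    exact ContinuousLinearMap.ext fun r ↦
      (mfderiv 𝓘(ℝ, F) 𝓘(ℝ, E) φ (γ t)).map_smul r
        (unitTangentialPart (E := E) (F := F) φ V (γ t))
  exact hL ▸ hcomp

theorem hasGeodesicSplitting
    (h : IsConstantAngleHypersurface (F := F) φ U V θ) :
    HasGeodesicSplitting (F := F) (unitTangentialPart (E := E) (F := F) φ V) := by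
  have hsm := h.contMDiff_unitTangentialPart
  have hcl := h.isSmoothClosed_flat_unitTangentialPart
  have hnorm := h.norm_unitTangentialPart
  have hne (x : N) : unitTangentialPart (E := E) (F := F) φ V x ≠ 0 := fun h0 ↦ by
    have := hnorm x
    rw [h0, norm_zero] at this
    exact zero_ne_one this
  refine ⟨hsm, hne, fun x ↦ (Submodule.span ℝ {unitTangentialPart (E := E) (F := F) φ V x})ᗮ,
    fun x ↦ rfl, fun x ↦ Submodule.isCompl_orthogonal _,
    fun γ s hs hγ ↦ ?_, ?_⟩
  · refine isGeodesicOn_of_isMIntegralCurveOn hsm (fun x ↦ ?_) hs hγ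
    exact leviCivita_self_eq_zero hsm hnorm x (hcl x _ (mem_extChartAt_target x)).2
  -- The complement of `T` is rewritten as the kernel of its closed dual form.
  · have hD : (fun x : N ↦ (Submodule.span ℝ {unitTangentialPart (E := E) (F := F) φ V x})ᗮ) =
        fun x ↦ (flat (unitTangentialPart (E := E) (F := F) φ V) x).ker := by
      funext x
      ext w
      exact Submodule.mem_orthogonal_singleton_iff_inner_right
    rw [hD]
    refine isIntegrable_ker hcl fun x h0 ↦ hne x ?_
    have h1 := DFunLike.congr_fun h0 (unitTangentialPart (E := E) (F := F) φ V x)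
    exact inner_self_eq_zero.1 h1

end IsConstantAngleHypersurface

end Hypersurface

end ConstantAngle

end

theorem proposition3p7 {n : ℕ} (hn : 3 < n + 1)
    -- a complete smooth Riemannian manifold of dimension `n + 1`
    {M : Type*} [EMetricSpace M] [ChartedSpace (EuclideanSpace ℝ (Fin (n + 1))) M]
    [IsManifold (𝓡 (n + 1)) ∞ M]
    [RiemannianBundle (fun x : M ↦ TangentSpace (𝓡 (n + 1)) x)]
    [IsContMDiffRiemannianBundle (𝓡 (n + 1)) ∞ (EuclideanSpace ℝ (Fin (n + 1)))
      (fun x : M ↦ TangentSpace (𝓡 (n + 1)) x)]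
    [IsRiemannianManifold (𝓡 (n + 1)) M] [CompleteSpace M]
    -- a smooth manifold of dimension `n` with a smooth Riemannian metric
    {N : Type*} [TopologicalSpace N] [T2Space N] [ChartedSpace (EuclideanSpace ℝ (Fin n)) N]
    [IsManifold (𝓡 n) ∞ N]
    [RiemannianBundle (fun x : N ↦ TangentSpace (𝓡 n) x)]
    [IsContMDiffRiemannianBundle (𝓡 n) ∞ (EuclideanSpace ℝ (Fin n))
      (fun x : N ↦ TangentSpace (𝓡 n) x)]
    (φ : N → M) (U : Π x : N, TangentSpace (𝓡 (n + 1)) (φ x))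
    (V : Π x : M, TangentSpace (𝓡 (n + 1)) x) (θ : ℝ)
    (h : IsConstantAngleHypersurface (F := EuclideanSpace ℝ (Fin n)) φ U V θ) :
    (Real.cos θ = 0 ∧
      IsRuled (E := EuclideanSpace ℝ (Fin (n + 1))) (F := EuclideanSpace ℝ (Fin n)) φ) ∨
    (Real.cos θ ≠ 0 ∧
      HasGeodesicSplitting (F := EuclideanSpace ℝ (Fin n)) (unitTangentialPart φ V)) := by
  by_cases hcos : Real.cos θ = 0
  · exact Or.inl ⟨hcos, h.isRuled hcos⟩
  · exact Or.inr ⟨hcos, h.hasGeodesicSplitting⟩
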